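/- Let $\Lambda$ be a commutative local uniserial ring of length $n$ (its ideals form a chain, and $\Lambda$ has length $n$ as a module over itself; so $n\geq 1$), let $p$ be a generator of its maximal ideal and $k=\Lambda/(p)$ its residue field. Let $\mathcal S_2(\Lambda)$ be the category of pairs $(B;A)$, where $B$ is a finitely generated $\Lambda$-module and $A\subseteq B$ a submodule with $p^2A=0$; a morphism $(B;A)\to(D;C)$ is a $\Lambda$-linear map $f:B\to D$ with $f(A)\subseteq C$. For $0\leq m\leq \ell\leq n$ with $m\le 2$ and $\ell\geq 1$, the picket $P^\ell_m$ is the pair $(\Lambda/(p^\ell);\,p^{\ell-m}\Lambda/(p^\ell))$. For integers $s,t$ with $0\leq s-1<t-2\leq n-2$, let $Q^t_s$ be the pair $(\Lambda/(p^t)\oplus\Lambda/(p^s);\,\Lambda\cdot(p^{t-2},p^{s-1}))$. Let $\mathcal P_n$ be the poset consisting of the chain $n-1<n-2<\dots<1$ and of two further points $1',1''$, each incomparable to all other points. Let $\mathrm{rep}_k\mathcal P_n$ be the category of finite dimensional representations of $\mathcal P_n$: an object $V$ is a finite dimensional $k$-vector space $V^0$ with subspaces $V^i$ ($i\in\mathcal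 P_n$) such that $V^i\subseteq V^j$ whenever $i\le j$ in $\mathcal P_n$; a morphism $V\to W$ is a linear map $V^0\to W^0$ which maps each $V^i$ into $W^i$. Write $V'=V^{1'}$ and $V''=V^{1''}$. Let $\mathrm{rep}'_k\mathcal P_n$ be the full subcategory of those $V$ with $V^{n-1}\subseteq V'$ and $V'+V''=V^0$ (for $n=1$, $V^{n-1}$ is the total space $V^0$). For $0\le\ell<n$ and $\ell',\ell''\in\{0,1\}$, let $V_{\ell,\ell',\ell''}$ be the representation with total space $k$ in which $V^i=k$ if $1\leq i\leq\ell$, $V^i=0$ if $\ell<i\leq n-1$, $V'=k$ if $\ell'=1$, $V'=0$ if $\ell'=0$, $V''=k$ if $\ell''=1$ and $V''=0$ if $\ell''=0$. For $0\leq s<t<n$, let $W_{s,t}$ be the representation with total space $k\oplus k$ in which $V^i=k\oplus k$ for $1\leq i\leq s$, $V^i=k(1,1)$ for $s<i\leq t$, $V^i=0$ for $t<i\leq n-1$, $V'=k\oplus 0$ and $V''=0\oplus k$. For $(B;A)\in\mathcal S_2(\Lambda)$ put $A^-=\mathrm{rad}\,A=pA$ and $A^+=A+\mathrm{soc}\,B$,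 and for a submodule $C\subseteq B$ put $\widetilde C=((C\cap A^+)+A^-)/A^-$. Setting $V^0=A^+/A^-$, $V^\ell=\widetilde{\mathrm{rad}^\ell B}$ for $1\leq\ell\leq n-1$, $V'=\widetilde{\mathrm{soc}\,B}$ and $V''=\widetilde A$, and sending a morphism $(B;A)\to(D;C)$ to the induced map $A^+/A^-\to C^+/C^-$, defines a functor $F:\mathcal S_2(\Lambda)\to\mathrm{rep}_k\mathcal P_n$ with values in $\mathrm{rep}'_k\mathcal P_n$. Proposition. (1) There are isomorphisms $$F(P^\ell_0)\cong V_{\ell-1,1,0}\ (1\leq\ell\leq n),\qquad F(P^\ell_1)\cong V_{\ell-1,1,1}\ (1\leq\ell\leq n),$$ $$F(P^\ell_2)\cong V_{\ell-2,0,1}\ (2\leq\ell\leq n),\qquad F(Q^t_s)\cong W_{s-1,t-2}\ (0\leq s-1<t-2\leq n-2),$$ and the representations on the right hand sides are indecomposable. (2) The functor $F:\mathcal S_2(\Lambda)\to\mathrm{rep}'_k\mathcal P_n$ is dense: each object of $\mathrm{rep}'_k\mathcal P_n$ is isomorphic to $F(B;A)$ for some $(B;A)\in\mathcal S_2(\Lambda)$.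 (3) All the pairs $P^\ell_m$ ($m\le 2$, $m\leq\ell$, $1\leq\ell\leq n$) and $Q^t_s$ ($0\leq s-1<t-2\leq n-2$) are indecomposable in $\mathcal S_2(\Lambda)$, and they are pairwise nonisomorphic. -/

import Mathlib

open CategoryTheory CategoryTheory.Limits IsLocalRing

universe u

namespace BoundedPairs

/-- A commutative local ring `Λ` is uniserial of length `n`: its ideals form a chain, and `Λ` has
length `n` as a module over itself. -/
structure IsUniserialOfLength (Λ : Type u) [CommRing Λ] [IsLocalRing Λ] (n : ℕ) : Prop where
  total : ∀ I J : Ideal Λ, I ≤ J ∨ J ≤ I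
  length_eq : Module.length Λ Λ = n

theorem IsUniserialOfLength.isNoetherianRing {Λ : Type u} [CommRing Λ] [IsLocalRing Λ] {n : ℕ}
    (h : IsUniserialOfLength Λ n) : IsNoetherianRing Λ := by
  have h1 : Module.length Λ Λ ≠ ⊤ := by rw [h.length_eq]; exact ENat.natCast_ne_top n
  exact (isFiniteLength_iff_isNoetherian_isArtinian.mp (Module.length_ne_top_iff.mp h1)).1

theorem IsUniserialOfLength.pow_eq_bot {Λ : Type u} [CommRing Λ] [IsLocalRing Λ] {n : ℕ}
    (h : IsUniserialOfLength Λ n) : maximalIdeal Λ ^ n = ⊥ := by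
  by_contra hne
  have hN := h.isNoetherianRing
  have key : ∀ j, j ≤ n → ((j + 1 : ℕ) : ℕ∞) ≤ Order.height (maximalIdeal Λ ^ (n - j)) := by
    intro j
    induction j with
    | zero =>
      intro _
      have := Order.height_add_one_le (bot_lt_iff_ne_bot.mpr hne)
      simpa using this
    | succ j ih =>
      intro hj
      have h1 := ih (by omega)
      have hlt : maximalIdeal Λ ^ (n - j) < maximalIdeal Λ ^ (n - (j + 1)) := by
        refine lt_of_le_of_ne (Ideal.pow_le_pow_right (by omega)) ?_
        intro heq
        have hs : n - j = (n - (j + 1)) + 1 := by omega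
        have h0 : maximalIdeal Λ ^ (n - (j + 1)) = ⊥ := by
          refine Submodule.eq_bot_of_le_smul_of_le_jacobson_bot (maximalIdeal Λ) _
            (IsNoetherian.noetherian _) ?_ (IsLocalRing.maximalIdeal_le_jacobson _)
          rw [smul_eq_mul, ← pow_succ', ← hs, heq]
        apply hne
        rw [eq_bot_iff, ← h0]
        exact Ideal.pow_le_pow_right (by omega)
      have h2 := Order.height_add_one_le hlt
      refine le_trans ?_ h2
      push_cast at h1 ⊢
      gcongr
  have h1 := key n le_rfl
  simp only [Nat.sub_self, pow_zero, Ideal.one_eq_top] at h1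
  have h2 : Order.height (⊤ : Ideal Λ) = n := by
    rw [← h.length_eq]; exact (Module.length_eq_height (R := Λ) (M := Λ)).symm
  rw [h2] at h1
  have : n + 1 ≤ n := by exact_mod_cast h1
  omega

/-! ### Pairs consisting of a module and a bounded submodule -/

/-- The objects `(B; A)` of `S_m(Λ)`: a finitely generated `Λ`-module `B` and a submodule `A` which
is annihilated by `𝔪 ^ m`, that is, by `p ^ m` for any generator `p` of `𝔪`. -/
structure SubPair (Λ : Type u) [CommRing Λ] [IsLocalRing Λ] (m : ℕ) where
  B : Type u
  [addCommGroup : AddCommGroup B]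
  [module : Module Λ B]
  [finite : Module.Finite Λ B]
  A : Submodule Λ B
  bounded : maximalIdeal Λ ^ m • A = ⊥

attribute [instance] SubPair.addCommGroup SubPair.module SubPair.finite

namespace SubPair

variable {Λ : Type u} [CommRing Λ] [IsLocalRing Λ] {m : ℕ}

/-- The morphisms `(B; A) → (D; C)`: the `Λ`-linear maps `f : B → D` with `f(A) ⊆ C`. -/
def homs (X Y : SubPair Λ m) : AddSubgroup (X.B →ₗ[Λ] Y.B) where
  carrier := {f | ∀ a ∈ X.A, f a ∈ Y.A}
  add_mem' hf hg a ha := Y.A.add_mem (hf a ha) (hg a ha)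
  zero_mem' _ _ := Y.A.zero_mem
  neg_mem' hf a ha := Y.A.neg_mem (hf a ha)

instance : Category.{u} (SubPair Λ m) where
  Hom X Y := homs X Y
  id _ := ⟨LinearMap.id, fun _ ha => ha⟩
  comp f g := ⟨g.1.comp f.1, fun a ha => g.2 _ (f.2 a ha)⟩

instance : Preadditive (SubPair Λ m) where
  homGroup X Y := inferInstanceAs (AddCommGroup (homs X Y))
  add_comp _ _ _ f f' g := Subtype.ext (LinearMap.comp_add f.1 f'.1 g.1)
  comp_add _ _ _ f g g' := Subtype.ext (LinearMap.add_comp f.1 g'.1 g.1)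

/-- The direct sum `(B ⊕ D; A ⊕ C)`. -/
def directSum (X Y : SubPair Λ m) : SubPair Λ m where
  B := X.B × Y.B
  A := X.A.prod Y.A
  bounded := by
    rw [eq_bot_iff, Submodule.smul_le]
    rintro r hr ⟨a, c⟩ ⟨ha, hc⟩
    have h1 : r • a ∈ (⊥ : Submodule Λ X.B) := X.bounded ▸ Submodule.smul_mem_smul hr ha
    have h2 : r • c ∈ (⊥ : Submodule Λ Y.B) := Y.bounded ▸ Submodule.smul_mem_smul hr hc
    rw [Submodule.mem_bot] at h1 h2 ⊢
    exact Prod.ext h1 h2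

/-- The direct sum with its canonical inclusions and projections. -/
def bicone (X Y : SubPair Λ m) : BinaryBicone X Y where
  pt := directSum X Y
  fst := ⟨LinearMap.fst Λ X.B Y.B, fun _ h => h.1⟩
  snd := ⟨LinearMap.snd Λ X.B Y.B, fun _ h => h.2⟩
  inl := ⟨LinearMap.inl Λ X.B Y.B, fun _ h => ⟨h, Y.A.zero_mem⟩⟩
  inr := ⟨LinearMap.inr Λ X.B Y.B, fun _ h => ⟨X.A.zero_mem, h⟩⟩
  inl_fst := Subtype.ext (LinearMap.ext fun _ => rfl)
  inl_snd := Subtype.ext (LinearMap.ext fun _ => rfl)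
  inr_fst := Subtype.ext (LinearMap.ext fun _ => rfl)
  inr_snd := Subtype.ext (LinearMap.ext fun _ => rfl)

instance : HasBinaryBiproducts (SubPair Λ m) where
  has_binary_biproduct X Y := hasBinaryBiproduct_of_total (bicone X Y) <|
    Subtype.ext <| LinearMap.ext fun x =>
      (Prod.ext (add_zero _) (zero_add _) : ((x.1 + 0, 0 + x.2) : X.B × Y.B) = x)

variable {p : Λ}

/-- The picket `P^ℓ_m = (Λ/(p^ℓ); (p^{ℓ-m})/(p^ℓ))`, where `m ≤ ℓ`, regarded as an object of
`S_M(Λ)` for `m ≤ M`. -/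
def picket (hp : maximalIdeal Λ = Ideal.span {p}) (ℓ m : ℕ) {M : ℕ} (hm : m ≤ M) :
    SubPair Λ M where
  B := Λ ⧸ Ideal.span {p ^ ℓ}
  A := Submodule.span Λ {Ideal.Quotient.mk (Ideal.span {p ^ ℓ}) (p ^ (ℓ - m))}
  bounded := by
    rw [hp, Ideal.span_singleton_pow, Ideal.span, Submodule.span_smul_span,
      Set.singleton_smul_singleton, Submodule.span_singleton_eq_bot, Algebra.smul_def, Ideal.Quotient.algebraMap_eq,
      ← map_mul, Ideal.Quotient.eq_zero_iff_mem, Ideal.mem_span_singleton, ← pow_add]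
    exact pow_dvd_pow p (by omega)

/-- The pair `Q^t_s = (Λ/(p^t) ⊕ Λ/(p^s); Λ(p^{t-2}, p^{s-1}))`, where `1 ≤ s` and `2 ≤ t`. -/
def pairQ (hp : maximalIdeal Λ = Ideal.span {p}) (t s : ℕ) : SubPair Λ 2 where
  B := (Λ ⧸ Ideal.span {p ^ t}) × (Λ ⧸ Ideal.span {p ^ s})
  A := Submodule.span Λ {(Ideal.Quotient.mk (Ideal.span {p ^ t}) (p ^ (t - 2)),
    Ideal.Quotient.mk (Ideal.span {p ^ s}) (p ^ (s - 1)))}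
  bounded := by
    rw [hp, Ideal.span_singleton_pow, Ideal.span, Submodule.span_smul_span,
      Set.singleton_smul_singleton, Submodule.span_singleton_eq_bot, Prod.smul_mk, Prod.mk_eq_zero]
    constructor <;>
    · rw [Algebra.smul_def, Ideal.Quotient.algebraMap_eq, ← map_mul,
        Ideal.Quotient.eq_zero_iff_mem, Ideal.mem_span_singleton, ← pow_add]
      exact pow_dvd_pow p (by omega)

/-- The indices of the pickets `P^ℓ_m` with `m ≤ 2` and of the pairs `Q^t_s` over a ring of
length `n`. -/
inductive Index (n : ℕ) : Type
  | picket (ℓ m : ℕ) (one_le : 1 ≤ ℓ) (le_n : ℓ ≤ n) (le_len : m ≤ ℓ) (le_two : m ≤ 2) : Index n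
  | pairQ (t s : ℕ) (one_le : 1 ≤ s) (lt : s - 1 < t - 2) (le_n : t ≤ n) : Index n

/-- The picket or the pair `Q^t_s` with the given index. -/
def ofIndex (hp : maximalIdeal Λ = Ideal.span {p}) {n : ℕ} : Index n → SubPair Λ 2
  | .picket ℓ m _ _ _ h => picket hp ℓ m h
  | .pairQ t s _ _ _ => pairQ hp t s

end SubPair

/-! ### Representations of the poset `P_n` -/

/-- The poset `P_n`: the chain `n-1 < n-2 < ⋯ < 1` together with two points `1'`, `1''` which are
incomparable to all other points. -/
inductive Poset (n : ℕ) : Type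
  | chain (i : ℕ) (one_le : 1 ≤ i) (lt : i < n) : Poset n
  | prime : Poset n
  | dprime : Poset n

/-- The order relation of `P_n`. -/
def Poset.rel {n : ℕ} : Poset n → Poset n → Prop
  | .chain i _ _, .chain j _ _ => j ≤ i
  | .prime, .prime => True
  | .dprime, .dprime => True
  | _, _ => False

instance (n : ℕ) : PartialOrder (Poset n) where
  le := Poset.rel
  le_refl a := by cases a <;> simp [Poset.rel]
  le_trans a b c hab hbc := by
    cases a <;> cases b <;> cases c <;> grind [Poset.rel]
  le_antisymm a b hab hba := by
    cases a <;> cases b <;> grind [Poset.rel]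

/-- A (finite dimensional) `k`-linear representation of `P_n`: a vector space with an order
preserving family of subspaces. -/
structure Rep (k : Type u) [Field k] (n : ℕ) where
  V : Type u
  [addCommGroup : AddCommGroup V]
  [module : Module k V]
  [finite : FiniteDimensional k V]
  sub : Poset n →o Submodule k V

attribute [instance] Rep.addCommGroup Rep.module Rep.finite

namespace Rep

variable {k : Type u} [Field k] {n : ℕ}

/-- The morphisms of representations: linear maps of the total spaces which preserve the
subspaces. -/
def homs (V W : Rep k n) : AddSubgroup (V.V →ₗ[k] W.V) where
  carrier := {f | ∀ i, ∀ v ∈ V.sub i, f v ∈ W.sub i}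
  add_mem' hf hg i v hv := (W.sub i).add_mem (hf i v hv) (hg i v hv)
  zero_mem' i _ _ := (W.sub i).zero_mem
  neg_mem' hf i v hv := (W.sub i).neg_mem (hf i v hv)

instance : Category.{u} (Rep k n) where
  Hom V W := homs V W
  id _ := ⟨LinearMap.id, fun _ _ hv => hv⟩
  comp f g := ⟨g.1.comp f.1, fun i v hv => g.2 i _ (f.2 i v hv)⟩

instance : Preadditive (Rep k n) where
  homGroup V W := inferInstanceAs (AddCommGroup (homs V W))
  add_comp _ _ _ f f' g := Subtype.ext (LinearMap.comp_add f.1 f'.1 g.1)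
  comp_add _ _ _ f g g' := Subtype.ext (LinearMap.add_comp f.1 g'.1 g.1)

/-- The direct sum of two representations. -/
def directSum (V W : Rep k n) : Rep k n where
  V := V.V × W.V
  sub := ⟨fun i => (V.sub i).prod (W.sub i), fun _ _ h =>
    Submodule.prod_mono (V.sub.monotone h) (W.sub.monotone h)⟩

/-- The direct sum with its canonical inclusions and projections. -/
def bicone (V W : Rep k n) : BinaryBicone V W where
  pt := directSum V W
  fst := ⟨LinearMap.fst k V.V W.V, fun _ _ h => h.1⟩
  snd := ⟨LinearMap.snd k V.V W.V, fun _ _ h => h.2⟩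
  inl := ⟨LinearMap.inl k V.V W.V, fun i _ h => ⟨h, (W.sub i).zero_mem⟩⟩
  inr := ⟨LinearMap.inr k V.V W.V, fun i _ h => ⟨(V.sub i).zero_mem, h⟩⟩
  inl_fst := Subtype.ext (LinearMap.ext fun _ => rfl)
  inl_snd := Subtype.ext (LinearMap.ext fun _ => rfl)
  inr_fst := Subtype.ext (LinearMap.ext fun _ => rfl)
  inr_snd := Subtype.ext (LinearMap.ext fun _ => rfl)

instance : HasBinaryBiproducts (Rep k n) where
  has_binary_biproduct V W := hasBinaryBiproduct_of_total (bicone V W) <|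
    Subtype.ext <| LinearMap.ext fun x =>
      (Prod.ext (add_zero _) (zero_add _) : ((x.1 + 0, 0 + x.2) : V.V × W.V) = x)

/-- The space `V^i` for `0 ≤ i ≤ n-1`, where `V^0` is the total space. -/
def level (V : Rep k n) (i : ℕ) : Submodule k V.V :=
  if h : 1 ≤ i ∧ i < n then V.sub (.chain i h.1 h.2) else ⊤

/-- The objects of `rep'_k P_n`: the representations with `V^{n-1} ⊆ V'` and `V' + V'' = V^0`. -/
def restricted (k : Type u) [Field k] (n : ℕ) : ObjectProperty (Rep k n) := fun V =>
  V.level (n - 1) ≤ V.sub .prime ∧ V.sub .prime ⊔ V.sub .dprime = ⊤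

/-- The representation `V_{ℓ,ℓ',ℓ''}` with total space `k`. -/
def repV (k : Type u) [Field k] (n : ℕ) (ℓ : ℕ) (ℓ' ℓ'' : Fin 2) : Rep k n where
  V := k
  sub :=
    { toFun := fun x => match x with
        | .chain i _ _ => if i ≤ ℓ then ⊤ else ⊥
        | .prime => if ℓ' = 1 then ⊤ else ⊥
        | .dprime => if ℓ'' = 1 then ⊤ else ⊥
      monotone' := by
        intro a b hab
        change Poset.rel a b at hab
        cases a <;> cases b <;> simp only [Poset.rel] at hab <;> try exact le_rfl
        dsimp only
        split_ifs <;> first | exact bot_le | exact le_top | omega }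

/-- The representation `W_{s,t}` with total space `k ⊕ k`. -/
def repW (k : Type u) [Field k] (n : ℕ) (s t : ℕ) : Rep k n where
  V := k × k
  sub :=
    { toFun := fun x => match x with
        | .chain i _ _ => if i ≤ s then ⊤ else if i ≤ t then Submodule.span k {(1, 1)} else ⊥
        | .prime => Submodule.prod ⊤ ⊥
        | .dprime => Submodule.prod ⊥ ⊤
      monotone' := by
        intro a b hab
        change Poset.rel a b at hab
        cases a <;> cases b <;> simp only [Poset.rel] at hab <;> try exact le_rfl
        dsimp only
        split_ifs <;> first | exact bot_le | exact le_top | exact le_rfl | omega }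

end Rep

/-! ### The functor `F` -/

namespace SubPair

variable {Λ : Type u} [CommRing Λ] [IsLocalRing Λ]

/-- The socle of a module over the local ring `Λ`: the elements annihilated by `𝔪`. -/
abbrev soc (Λ : Type u) [CommRing Λ] [IsLocalRing Λ] (B : Type u) [AddCommGroup B] [Module Λ B] :
    Submodule Λ B :=
  Submodule.torsionBySet Λ B (maximalIdeal Λ : Set Λ)

/-- `rad^ℓ B = 𝔪^ℓ B`. -/
abbrev radPow (Λ : Type u) [CommRing Λ] [IsLocalRing Λ] (B : Type u) [AddCommGroup B] [Module Λ B]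
    (ℓ : ℕ) : Submodule Λ B :=
  maximalIdeal Λ ^ ℓ • (⊤ : Submodule Λ B)

/-- `A⁻ = rad A = 𝔪 A`. -/
def minus (X : SubPair Λ 2) : Submodule Λ X.B := maximalIdeal Λ • X.A

/-- `A⁺ = A + soc B`. -/
def plus (X : SubPair Λ 2) : Submodule Λ X.B := X.A ⊔ soc Λ X.B

/-- The total space `A⁺ / A⁻`. -/
abbrev Total (X : SubPair Λ 2) : Type u := X.plus ⧸ X.minus.submoduleOf X.plus

theorem isTorsion_total (X : SubPair Λ 2) :
    Module.IsTorsionBySet Λ X.Total (maximalIdeal Λ : Set Λ) := by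
  rintro y ⟨r, hr⟩
  obtain ⟨⟨x, hx⟩, rfl⟩ := Submodule.Quotient.mk_surjective _ y
  change Submodule.Quotient.mk (r • (⟨x, hx⟩ : X.plus)) = 0
  rw [Submodule.Quotient.mk_eq_zero, Submodule.submoduleOf, Submodule.mem_comap]
  change r • x ∈ X.minus
  obtain ⟨a, ha, s, hs, rfl⟩ := Submodule.mem_sup.mp hx
  rw [smul_add, (Submodule.mem_torsionBySet_iff _ _).mp hs ⟨r, hr⟩, add_zero]
  exact Submodule.smul_mem_smul hr ha

/-- `A⁺ / A⁻` as a vector space over the residue field. -/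
noncomputable instance (X : SubPair Λ 2) : Module (ResidueField Λ) X.Total :=
  Module.IsTorsionBySet.module X.isTorsion_total

instance (X : SubPair Λ 2) : IsScalarTower Λ (ResidueField Λ) X.Total :=
  Module.IsTorsionBySet.isScalarTower (S := Λ) X.isTorsion_total

/-- A `Λ`-submodule of `A⁺ / A⁻` as a subspace. -/
def toSubspace (X : SubPair Λ 2) (N : Submodule Λ X.Total) :
    Submodule (ResidueField Λ) X.Total where
  carrier := N
  add_mem' := N.add_mem
  zero_mem' := N.zero_mem
  smul_mem' c x hx := by
    obtain ⟨r, rfl⟩ := residue_surjective c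
    have h : residue Λ r • x = r • x := algebraMap_smul (ResidueField Λ) r x
    rw [h]
    exact N.smul_mem r hx

/-- The subspace `((C ∩ A⁺) + A⁻) / A⁻` of `A⁺ / A⁻`. -/
def tilde (X : SubPair Λ 2) (C : Submodule Λ X.B) : Submodule (ResidueField Λ) X.Total :=
  X.toSubspace ((C.submoduleOf X.plus).map (X.minus.submoduleOf X.plus).mkQ)

theorem tilde_mono (X : SubPair Λ 2) {C D : Submodule Λ X.B} (h : C ≤ D) :
    X.tilde C ≤ X.tilde D :=
  Submodule.map_mono (f := (X.minus.submoduleOf X.plus).mkQ)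
    (Submodule.comap_mono (f := X.plus.subtype) h)

theorem finite_total [IsNoetherianRing Λ] (X : SubPair Λ 2) :
    FiniteDimensional (ResidueField Λ) X.Total := by
  have : IsNoetherian Λ X.B := isNoetherian_of_isNoetherianRing_of_finite Λ X.B
  exact Module.Finite.of_restrictScalars_finite Λ (ResidueField Λ) X.Total

theorem minus_map {X Y : SubPair Λ 2} (f : homs X Y) : X.minus ≤ Y.minus.comap f.1 :=
  Submodule.smul_le.mpr fun r hr a ha => by
    rw [Submodule.mem_comap, map_smul]
    exact Submodule.smul_mem_smul hr (f.2 a ha)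

theorem soc_map {B D : Type u} [AddCommGroup B] [AddCommGroup D] [Module Λ B] [Module Λ D]
    (f : B →ₗ[Λ] D) : soc Λ B ≤ (soc Λ D).comap f := by
  intro b hb
  rw [Submodule.mem_comap, Submodule.mem_torsionBySet_iff]
  intro r
  rw [← map_smul, (Submodule.mem_torsionBySet_iff _ _).mp hb r, map_zero]

theorem radPow_map {B D : Type u} [AddCommGroup B] [AddCommGroup D] [Module Λ B] [Module Λ D]
    (f : B →ₗ[Λ] D) (ℓ : ℕ) : radPow Λ B ℓ ≤ (radPow Λ D ℓ).comap f :=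
  Submodule.smul_le.mpr fun r hr a _ => by
    rw [Submodule.mem_comap, map_smul]
    exact Submodule.smul_mem_smul hr trivial

theorem plus_map {X Y : SubPair Λ 2} (f : homs X Y) : X.plus ≤ Y.plus.comap f.1 :=
  sup_le (fun a ha => Submodule.mem_sup_left (f.2 a ha))
    (fun _ hb => Submodule.mem_sup_right (soc_map f.1 hb))

/-- The map `A⁺ / A⁻ → C⁺ / C⁻` induced by a morphism `(B; A) → (D; C)`. -/
noncomputable def totalMap {X Y : SubPair Λ 2} (f : homs X Y) : X.Total →ₗ[ResidueField Λ] Y.Total :=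
  LinearMap.extendScalarsOfSurjective (R := Λ) residue_surjective
    (Submodule.mapQ (X.minus.submoduleOf X.plus) (Y.minus.submoduleOf Y.plus)
      (f.1.restrict (plus_map f)) (fun _ hx => minus_map f hx))

theorem totalMap_mk {X Y : SubPair Λ 2} (f : homs X Y) (x : X.plus) :
    totalMap f (Submodule.Quotient.mk x) = Submodule.Quotient.mk ⟨f.1 x, plus_map f x.2⟩ := rfl

theorem totalMap_tilde {X Y : SubPair Λ 2} (f : homs X Y) {C : Submodule Λ X.B}
    {D : Submodule Λ Y.B} (h : C ≤ D.comap f.1) :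
    ∀ v ∈ X.tilde C, totalMap f v ∈ Y.tilde D := by
  rintro _ ⟨x, hx, rfl⟩
  exact ⟨⟨f.1 x, plus_map f x.2⟩, h hx, rfl⟩

/-- The submodules of `B` which give rise to the subspaces of `F(B; A)`. -/
def source (X : SubPair Λ 2) {n : ℕ} : Poset n → Submodule Λ X.B
  | .chain ℓ _ _ => radPow Λ X.B ℓ
  | .prime => soc Λ X.B
  | .dprime => X.A

theorem source_mono (X : SubPair Λ 2) {n : ℕ} {a b : Poset n} (h : a ≤ b) :
    X.source a ≤ X.source b := by
  change Poset.rel a b at h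
  cases a <;> cases b <;> simp only [Poset.rel] at h <;> try exact le_rfl
  exact Submodule.smul_mono_left (Ideal.pow_le_pow_right h)

theorem source_map {X Y : SubPair Λ 2} {n : ℕ} (f : homs X Y) (a : Poset n) :
    X.source a ≤ (Y.source a).comap f.1 := by
  cases a with
  | chain ℓ _ _ => exact radPow_map f.1 ℓ
  | prime => exact soc_map f.1
  | dprime => exact f.2

end SubPair

section Functor

variable {Λ : Type u} [CommRing Λ] [IsLocalRing Λ] {n : ℕ}

/-- The functor `F : S_2(Λ) ⥤ rep_k P_n`. -/
noncomputable def F (hΛ : IsUniserialOfLength Λ n) : SubPair Λ 2 ⥤ Rep (ResidueField Λ) n where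
  obj X :=
    { V := X.Total
      finite := have := hΛ.isNoetherianRing; X.finite_total
      sub := ⟨fun a => X.tilde (X.source a), fun _ _ h => X.tilde_mono (X.source_mono h)⟩ }
  map f := ⟨SubPair.totalMap f, fun a => SubPair.totalMap_tilde f (SubPair.source_map f a)⟩
  map_id X := Subtype.ext <| LinearMap.ext fun x => by
    obtain ⟨x, rfl⟩ := Submodule.Quotient.mk_surjective _ x
    rfl
  map_comp f g := Subtype.ext <| LinearMap.ext fun x => by
    obtain ⟨x, rfl⟩ := Submodule.Quotient.mk_surjective _ x
    rfl

theorem F_restricted (hΛ : IsUniserialOfLength Λ n) (X : SubPair Λ 2) :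
    Rep.restricted (ResidueField Λ) n ((F hΛ).obj X) := by
  have hrad : ∀ i, n ≤ i + 1 → SubPair.radPow Λ X.B i ≤ SubPair.soc Λ X.B := by
    intro i hi
    refine Submodule.smul_le.mpr fun r hr b _ => ?_
    rw [Submodule.mem_torsionBySet_iff]
    rintro ⟨s, hs⟩
    have h0 : s * r ∈ maximalIdeal Λ ^ n :=
      Ideal.pow_le_pow_right hi (by rw [pow_succ']; exact Ideal.mul_mem_mul hs hr)
    rw [hΛ.pow_eq_bot, Ideal.mem_bot] at h0
    change s • r • b = 0
    rw [smul_smul, h0, zero_smul]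
  have htop : n ≤ 1 → X.tilde (SubPair.soc Λ X.B) = ⊤ := by
    intro hn
    have hs : SubPair.soc Λ X.B = ⊤ := by
      rw [eq_top_iff]
      refine le_trans ?_ (hrad 0 (by omega))
      simp [SubPair.radPow]
    rw [eq_top_iff]
    intro v _
    obtain ⟨x, rfl⟩ := Submodule.Quotient.mk_surjective _ v
    exact ⟨x, show (x : X.B) ∈ SubPair.soc Λ X.B by rw [hs]; trivial, rfl⟩
  constructor
  · unfold Rep.level
    split_ifs with h
    · exact X.tilde_mono (hrad _ (by omega))
    · exact (htop (by omega)).ge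
  · rw [eq_top_iff]
    intro v _
    obtain ⟨⟨x, hx⟩, rfl⟩ := Submodule.Quotient.mk_surjective _ v
    obtain ⟨a, ha, s, hs, rfl⟩ := Submodule.mem_sup.mp hx
    refine Submodule.mem_sup.mpr ⟨Submodule.Quotient.mk ⟨s, Submodule.mem_sup_right hs⟩,
      ⟨⟨s, Submodule.mem_sup_right hs⟩, hs, rfl⟩,
      Submodule.Quotient.mk ⟨a, Submodule.mem_sup_left ha⟩,
      ⟨⟨a, Submodule.mem_sup_left ha⟩, ha, rfl⟩, ?_⟩
    refine (Submodule.Quotient.mk_add _).symm.trans (congrArg _ (Subtype.ext ?_))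
    exact add_comm s a

/-- The functor `F`, regarded as a functor `S_2(Λ) ⥤ rep'_k P_n`. -/
noncomputable def F' (hΛ : IsUniserialOfLength Λ n) :
    SubPair Λ 2 ⥤ (Rep.restricted (ResidueField Λ) n).FullSubcategory :=
  (Rep.restricted (ResidueField Λ) n).lift (F hΛ) (F_restricted hΛ)

end Functor

end BoundedPairs

open BoundedPairs

/-!
The functor `F` is additive, and it reflects zero objects because `rad Λ` is nilpotent, so that
a nonzero module has a nonzero socle. So once the values of `F` on the pickets and on the pairs
`Q^t_s` are known, these pairs are indecomposable and pairwise nonisomorphic because their images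
are.

For density it suffices to split off from every nonzero `V` in `rep'_k P_n` a summand `V_{ℓ,ℓ',ℓ''}`
or `W_{s,t}` that is a value of `F`. Let `t` be maximal with `V^t ≠ 0`, where `V^0` is the total
space. If `V^t` meets `V'` or `V''`, a nonzero vector in the intersection spans a one-dimensional
summand. Otherwise write a nonzero `x ∈ V^t` as `y + (x - y)` with `y ∈ V' ∩ V^s`, `x - y ∈ V''` and
`s` maximal: the vectors `y` and `x - y` span a summand `W_{s,t}`.
-/

namespace BoundedPairs

section Ring

section OrderOfVanishing

variable {R : Type*} [CommRing R]

theorem length_le_add_of_exact {M N P : Type*} [AddCommGroup M] [AddCommGroup N] [AddCommGroup P]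
    [Module R M] [Module R N] [Module R P] {f : N →ₗ[R] M} {g : M →ₗ[R] P}
    (hg : Function.Surjective g) (hfg : Function.Exact f g) :
    Module.length R M ≤ Module.length R N + Module.length R P := by
  rw [Module.length_eq_add_of_exact (LinearMap.ker g).subtype g (Submodule.subtype_injective _) hg
    (LinearMap.exact_subtype_ker_map g), hfg.linearMap_ker_eq]
  gcongr
  exact Module.length_le_of_surjective f.rangeRestrict f.surjective_rangeRestrict

open Pointwise in
theorem ord_mul_le (a b : R) : Ring.ord R (a * b) ≤ Ring.ord R a + Ring.ord R b := by
  have h := length_le_add_of_exact (Ideal.quotOfMul_surjective (Ideal.span {b}))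
    (Ideal.exact_mulQuot_quotOfMul (a := a) (Ideal.span {b}))
  have hab : a • Ideal.span {b} = Ideal.span {a * b} := by
    simp only [← Ideal.submodule_span_eq, ← Submodule.singleton_set_smul, Submodule.set_smul_span,
      smul_eq_mul, Set.singleton_mul_singleton]
  rw [hab, add_comm] at h
  exact h

theorem ord_pow_le (a : R) (i : ℕ) : Ring.ord R (a ^ i) ≤ i * Ring.ord R a := by
  induction i with
  | zero => simp
  | succ i ih =>
    rw [pow_succ, Nat.cast_succ, add_one_mul]
    exact (ord_mul_le _ _).trans (by gcongr)

theorem ord_eq_one {a : R} (ha : (Ideal.span {a}).IsMaximal) : Ring.ord R a = 1 :=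
  Module.length_eq_one_iff.mpr (isSimpleModule_iff_isCoatom.mpr ha.out)

end OrderOfVanishing

namespace IsUniserialOfLength

variable {Λ : Type u} [CommRing Λ] [IsLocalRing Λ] {n : ℕ} {p : Λ}

theorem one_le (h : IsUniserialOfLength Λ n) : 1 ≤ n := by
  have hpos : 0 < Module.length Λ Λ := Module.length_pos
  rw [h.length_eq] at hpos
  exact_mod_cast hpos

theorem pow_ne_zero (h : IsUniserialOfLength Λ n) (hp : maximalIdeal Λ = Ideal.span {p})
    {i : ℕ} (hi : i < n) : p ^ i ≠ 0 := by
  intro h0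
  have hle := ord_pow_le p i
  rw [h0, Ring.ord_zero, h.length_eq, ord_eq_one (hp ▸ maximalIdeal.isMaximal Λ), mul_one] at hle
  exact hi.not_ge (by exact_mod_cast hle)

theorem not_pow_dvd_pow (h : IsUniserialOfLength Λ n) (hp : maximalIdeal Λ = Ideal.span {p})
    {i j : ℕ} (hij : i < j) (hj : j ≤ n) : ¬ p ^ j ∣ p ^ i := by
  rintro ⟨c, hc⟩
  have hmem : p ^ (j - i) * c ∈ maximalIdeal Λ := by
    rw [hp, Ideal.mem_span_singleton]
    exact (dvd_pow_self p (by omega)).mul_right c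
  have hunit : IsUnit (1 - p ^ (j - i) * c) := (isUnit_or_isUnit_of_add_one
    (sub_add_cancel 1 (p ^ (j - i) * c))).resolve_right hmem
  refine h.pow_ne_zero hp (hij.trans_le hj) (hunit.mul_left_eq_zero.mp ?_)
  rw [mul_sub, mul_one, ← mul_assoc, ← pow_add, Nat.add_sub_cancel' hij.le, ← hc, sub_self]

theorem pow_dvd_mul_pow_iff (h : IsUniserialOfLength Λ n) (hp : maximalIdeal Λ = Ideal.span {p})
    {i j : ℕ} (hj : j ≤ n) {a : Λ} : p ^ j ∣ a * p ^ i ↔ p ^ (j - i) ∣ a := by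
  refine ⟨fun ha => ?_, fun ha => (pow_dvd_pow p (by omega : j ≤ j - i + i)).trans
    (pow_add p _ i ▸ mul_dvd_mul_right ha _)⟩
  suffices H : ∀ r ≤ j - i, p ^ r ∣ a from H _ le_rfl
  intro r hr
  induction r with
  | zero => simp
  | succ r ih =>
    obtain ⟨b, rfl⟩ := ih (by omega)
    suffices hb : p ∣ b from pow_succ p r ▸ mul_dvd_mul_left _ hb
    by_contra hb
    rw [← Ideal.mem_span_singleton, ← hp, notMem_maximalIdeal] at hb
    rw [mul_right_comm, hb.dvd_mul_right, ← pow_add] at ha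
    exact h.not_pow_dvd_pow hp (by omega) hj ha

end IsUniserialOfLength

end Ring

section Category

variable {C : Type*} [Category C]

theorem indecomposable_of_iso [HasZeroMorphisms C] [HasBinaryBiproducts C] {X Y : C} (i : X ≅ Y)
    (h : Indecomposable Y) : Indecomposable X :=
  ⟨fun h0 => h.1 (h0.of_iso i.symm), fun A B j => h.2 A B (i.symm ≪≫ j)⟩

variable [Preadditive C] [HasBinaryBiproducts C]

theorem indecomposable_of_idempotents {X : C} (h0 : ¬ IsZero X)
    (h : ∀ e : X ⟶ X, e ≫ e = e → e = 0 ∨ e = 𝟙 X) : Indecomposable X := by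
  refine ⟨h0, fun Y Z i => ?_⟩
  have hconj : biprod.fst ≫ (biprod.inl : Y ⟶ Y ⊞ Z) =
      i.inv ≫ (i.hom ≫ biprod.fst ≫ biprod.inl ≫ i.inv) ≫ i.hom := by simp
  rcases h (i.hom ≫ biprod.fst ≫ biprod.inl ≫ i.inv) (by simp) with he | he <;> rw [he] at hconj
  · left
    rw [IsZero.iff_id_eq_zero]
    simpa using congrArg (fun f => biprod.inl ≫ f ≫ biprod.fst) hconj
  · right
    rw [IsZero.iff_id_eq_zero]
    simpa using (congrArg (fun f => biprod.inr ≫ f ≫ biprod.snd) hconj).symm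

theorem indecomposable_of_map {D : Type*} [Category D] [Preadditive D] [HasBinaryBiproducts D]
    (G : C ⥤ D) [G.Additive] (hG : ∀ X, IsZero (G.obj X) → IsZero X) {X : C}
    (h : Indecomposable (G.obj X)) : Indecomposable X := by
  refine ⟨fun h0 => h.1 (G.map_isZero h0), fun Y Z i => ?_⟩
  have := preservesBinaryBiproducts_of_preservesBiproducts G
  exact (h.2 _ _ (G.mapIso i ≪≫ G.mapBiprod Y Z)).imp (hG Y) (hG Z)

end Category

section LinearAlgebra

theorem exists_linearMap_eqOn_of_sup_eq_top {R M P : Type*} [Ring R] [AddCommGroup M] [Module R M]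
    [AddCommGroup P] [Module R P] {N₁ N₂ : Submodule R M} (h : N₁ ⊔ N₂ = ⊤) {f g : M →ₗ[R] P}
    (hfg : Set.EqOn f g (N₁ ⊓ N₂ : Submodule R M)) :
    ∃ φ : M →ₗ[R] P, Set.EqOn φ f N₁ ∧ Set.EqOn φ g N₂ := by
  have hcompat : ∀ (x : N₁) (y : N₂), (x : M) = y → f.domRestrict N₁ x = g.domRestrict N₂ y := by
    rintro ⟨x, hx⟩ ⟨y, hy⟩ rfl
    exact hfg ⟨hx, hy⟩
  let F := LinearPMap.sup ⟨N₁, f.domRestrict N₁⟩ ⟨N₂, g.domRestrict N₂⟩ hcompat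
  refine ⟨F.toFun ∘ₗ (LinearEquiv.ofTop F.domain h).symm, fun x hx => ?_, fun x hx => ?_⟩
  · exact ((LinearPMap.left_le_sup _ _ hcompat).2 (x := ⟨x, hx⟩) rfl).symm
  · exact ((LinearPMap.right_le_sup _ _ hcompat).2 (x := ⟨x, hx⟩) rfl).symm

end LinearAlgebra

namespace Rep

variable {k : Type u} [Field k] {n : ℕ}

/-- The morphism of representations given by a linear map which preserves the subspaces. -/
def ofLinear {V W : Rep k n} (f : V.V →ₗ[k] W.V) (hf : ∀ i, ∀ v ∈ V.sub i, f v ∈ W.sub i) :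
    V ⟶ W := ⟨f, hf⟩

/-- The linear map of total spaces which underlies a morphism. -/
def toLinear {V W : Rep k n} (f : V ⟶ W) : V.V →ₗ[k] W.V := Subtype.val f

theorem toLinear_mem {V W : Rep k n} (f : V ⟶ W) (i : Poset n) {v : V.V} (hv : v ∈ V.sub i) :
    toLinear f v ∈ W.sub i := Subtype.property f i v hv

@[ext]
theorem hom_ext {V W : Rep k n} {f g : V ⟶ W} (h : ∀ v, toLinear f v = toLinear g v) : f = g :=
  Subtype.ext (LinearMap.ext h)

@[simp]
theorem toLinear_ofLinear {V W : Rep k n} (f : V.V →ₗ[k] W.V) (hf) :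
    toLinear (ofLinear (V := V) (W := W) f hf) = f := rfl

@[simp]
theorem toLinear_id (V : Rep k n) (v : V.V) : toLinear (𝟙 V) v = v := rfl

@[simp]
theorem toLinear_comp {U V W : Rep k n} (f : U ⟶ V) (g : V ⟶ W) (v : U.V) :
    toLinear (f ≫ g) v = toLinear g (toLinear f v) := rfl

@[simp]
theorem toLinear_zero {V W : Rep k n} (v : V.V) : toLinear (0 : V ⟶ W) v = 0 := rfl

theorem isZero_iff {V : Rep k n} : IsZero V ↔ Subsingleton V.V := by
  rw [IsZero.iff_id_eq_zero]
  refine ⟨fun h => subsingleton_of_forall_eq 0 fun v => ?_, fun _ => hom_ext fun v =>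
    Subsingleton.elim _ _⟩
  rw [← toLinear_id V v, h, toLinear_zero]

/-- The isomorphism given by a linear equivalence which identifies the subspaces. -/
def isoOfLinearEquiv {V W : Rep k n} (e : V.V ≃ₗ[k] W.V)
    (h : ∀ i v, v ∈ V.sub i ↔ e v ∈ W.sub i) : V ≅ W where
  hom := ofLinear e.toLinearMap fun i v hv => (h i v).mp hv
  inv := ofLinear e.symm.toLinearMap fun i v hv => (h i _).mpr (by simpa using hv)
  hom_inv_id := by ext v; simp
  inv_hom_id := by ext v; simp

/-- The linear equivalence of total spaces which underlies an isomorphism. -/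
def linearEquivOfIso {V W : Rep k n} (f : V ≅ W) : V.V ≃ₗ[k] W.V :=
  LinearEquiv.ofLinearMap (toLinear f.hom) (toLinear f.inv)
    (LinearMap.ext fun w => by rw [LinearMap.comp_apply, ← toLinear_comp, f.inv_hom_id]; rfl)
    (LinearMap.ext fun v => by rw [LinearMap.comp_apply, ← toLinear_comp, f.hom_inv_id]; rfl)

theorem map_linearEquivOfIso_sub {V W : Rep k n} (f : V ≅ W) (i : Poset n) :
    (V.sub i).map (linearEquivOfIso f).toLinearMap = W.sub i := by
  ext w
  rw [Submodule.mem_map_equiv]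
  refine ⟨fun h => ?_, fun h => toLinear_mem f.inv i h⟩
  rw [← (linearEquivOfIso f).apply_symm_apply w]
  exact toLinear_mem f.hom i h

theorem sub_eq_top_iff_of_iso {V W : Rep k n} (f : V ≅ W) (i : Poset n) :
    V.sub i = ⊤ ↔ W.sub i = ⊤ := by
  rw [← map_linearEquivOfIso_sub f]
  exact Submodule.map_eq_top_iff.symm

theorem sub_eq_bot_iff_of_iso {V W : Rep k n} (f : V ≅ W) (i : Poset n) :
    V.sub i = ⊥ ↔ W.sub i = ⊥ := by
  rw [← map_linearEquivOfIso_sub f]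
  exact Submodule.map_eq_bot_iff.symm

theorem level_eq (V : Rep k n) {i : ℕ} (h1 : 1 ≤ i) (h2 : i < n) :
    V.level i = V.sub (.chain i h1 h2) := dif_pos ⟨h1, h2⟩

theorem level_zero (V : Rep k n) : V.level 0 = ⊤ := dif_neg (by omega)

theorem level_anti (V : Rep k n) {i j : ℕ} (hij : i ≤ j) (hj : j < n) :
    V.level j ≤ V.level i := by
  rcases Nat.eq_zero_or_pos i with rfl | hi
  · exact level_zero V ▸ le_top
  · rw [level_eq V hi (by omega), level_eq V (hi.trans_le hij) hj]
    exact V.sub.monotone (show Poset.rel _ _ from hij)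

theorem toLinear_mem_level {V W : Rep k n} (f : V ⟶ W) {i : ℕ} {v : V.V} (hv : v ∈ V.level i) :
    toLinear f v ∈ W.level i := by
  unfold level at hv ⊢
  split_ifs at hv ⊢
  · exact toLinear_mem f _ hv
  · exact Submodule.mem_top

section Retract

theorem toLinear_retract {U V : Rep k n} (h : Retract U V) (u : U.V) :
    toLinear h.r (toLinear h.i u) = u := by
  rw [← toLinear_comp, h.retract, toLinear_id]

instance : (restricted k n).IsStableUnderRetracts where
  of_retract {U V} h hV := by
    refine ⟨fun u hu => ?_, eq_top_iff.mpr fun u _ => ?_⟩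
    · rw [← toLinear_retract h u]
      exact toLinear_mem h.r _ (hV.1 (toLinear_mem_level h.i hu))
    · obtain ⟨a, ha, b, hb, hab⟩ :=
        Submodule.mem_sup.mp (hV.2.ge (Submodule.mem_top (x := toLinear h.i u)))
      rw [← toLinear_retract h u, ← hab, map_add]
      exact Submodule.add_mem_sup (toLinear_mem h.r _ ha) (toLinear_mem h.r _ hb)

/-- The restriction of a representation to a subspace of its total space. -/
def restrict (V : Rep k n) (H : Submodule k V.V) : Rep k n where
  V := H
  sub := ⟨fun i => (V.sub i).comap H.subtype, fun _ _ h => Submodule.comap_mono (V.sub.monotone h)⟩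

theorem exists_iso_biprod_of_retract {S V : Rep k n} (h : Retract S V) (hS : ¬ IsZero S) :
    ∃ K : Rep k n, Module.finrank k K.V < Module.finrank k V.V ∧ Nonempty (V ≅ K ⊞ S) := by
  let H := LinearMap.ker (toLinear h.r)
  have hker : ∀ v, v - toLinear h.i (toLinear h.r v) ∈ H := fun v => by
    rw [LinearMap.mem_ker, map_sub, toLinear_retract, sub_self]
  let j : V.restrict H ⟶ V := ofLinear H.subtype fun _ _ hv => hv
  let q : V ⟶ V.restrict H := ofLinear
    ((LinearMap.id - (toLinear h.i).comp (toLinear h.r)).codRestrict H hker)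
    fun i v hv => (V.sub i).sub_mem hv (toLinear_mem h.i i (toLinear_mem h.r i hv))
  let splitting : (ShortComplex.mk j h.r (hom_ext fun x => x.2)).Splitting :=
    { r := q
      s := h.i
      f_r := hom_ext fun (x : H) => Subtype.ext <| by
        change (x : V.V) - toLinear h.i (toLinear h.r (x : V.V)) = x
        rw [LinearMap.mem_ker.mp x.2, map_zero, sub_zero]
      s_g := h.retract
      id := hom_ext fun v => sub_add_cancel v (toLinear h.i (toLinear h.r v)) }
  refine ⟨V.restrict H, Submodule.finrank_lt fun htop => hS ?_, ⟨splitting.isoBinaryBiproduct⟩⟩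
  refine isZero_iff.mpr (subsingleton_of_forall_eq 0 fun s => ?_)
  rw [← toLinear_retract h s]
  exact LinearMap.mem_ker.mp (htop.ge Submodule.mem_top)

end Retract

theorem indecomposable_of_forall_eq_smul {V : Rep k n} [Nontrivial V.V]
    (h : ∀ e : V ⟶ V, ∃ c : k, ∀ v, toLinear e v = c • v) : Indecomposable V := by
  refine indecomposable_of_idempotents
    (fun h0 => not_subsingleton V.V (isZero_iff.mp h0)) fun e he => ?_
  obtain ⟨c, hc⟩ := h e
  obtain ⟨v, hv⟩ := exists_ne (0 : V.V)
  have hcc : c * c = c := smul_left_injective k hv <| by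
    change (c * c) • v = c • v
    rw [mul_smul, ← hc, ← hc, ← toLinear_comp, he, hc]
  rcases IsIdempotentElem.iff_eq_zero_or_one.mp hcc with rfl | rfl
  · exact Or.inl (hom_ext fun w => by rw [hc, zero_smul, toLinear_zero])
  · exact Or.inr (hom_ext fun w => by rw [hc, one_smul, toLinear_id])

section RepV

variable {ℓ : ℕ} {a b : Fin 2}

instance : Nontrivial (repV k n ℓ a b).V := inferInstanceAs (Nontrivial k)

theorem repV_sub_eq_bot_or_eq_top (i : Poset n) :
    (repV k n ℓ a b).sub i = ⊥ ∨ (repV k n ℓ a b).sub i = ⊤ := by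
  cases i <;> exact (ite_eq_or_eq _ _ _).symm

theorem repV_sub_chain_eq_top_iff {i : ℕ} {h1 : 1 ≤ i} {h2 : i < n} :
    (repV k n ℓ a b).sub (.chain i h1 h2) = ⊤ ↔ i ≤ ℓ :=
  top_ne_bot.ite_eq_left_iff

theorem repV_sub_prime_eq_top_iff : (repV k n ℓ a b).sub .prime = ⊤ ↔ a = 1 :=
  top_ne_bot.ite_eq_left_iff

theorem repV_sub_dprime_eq_top_iff : (repV k n ℓ a b).sub .dprime = ⊤ ↔ b = 1 :=
  top_ne_bot.ite_eq_left_iff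

theorem indecomposable_repV (ℓ : ℕ) (a b : Fin 2) : Indecomposable (repV k n ℓ a b) := by
  refine indecomposable_of_forall_eq_smul fun e => ?_
  let f : k →ₗ[k] k := toLinear e
  exact ⟨f 1, fun c : k => show f c = f 1 • c by rw [smul_eq_mul, mul_comm, ← smul_eq_mul,
    ← map_smul, smul_eq_mul, mul_one]⟩

theorem nonempty_iso_repV {V : Rep k n} {v : V.V} (hv : v ≠ 0) (hspan : ∀ x, ∃ c : k, c • v = x)
    (hmem : ∀ i, v ∈ V.sub i ↔ (repV k n ℓ a b).sub i = ⊤) : Nonempty (V ≅ repV k n ℓ a b) := by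
  let e : k ≃ₗ[k] V.V :=
    LinearEquiv.ofBijective (LinearMap.toSpanSingleton k V.V v) ⟨smul_left_injective k hv, hspan⟩
  refine ⟨(isoOfLinearEquiv (V := repV k n ℓ a b) e fun i (c : k) => ?_).symm⟩
  change _ ↔ c • v ∈ V.sub i
  rcases repV_sub_eq_bot_or_eq_top (k := k) (ℓ := ℓ) (a := a) (b := b) i with h | h <;> rw [h]
  · have hvi : v ∉ V.sub i := fun hi => bot_ne_top (h.symm.trans ((hmem i).mp hi))
    exact ⟨fun hc => (show c = 0 from hc) ▸ (zero_smul k v).symm ▸ zero_mem _,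
      fun hc => by_contra fun hc0 : c ≠ 0 => hvi ((Submodule.smul_mem_iff _ hc0).mp hc)⟩
  · exact ⟨fun _ => Submodule.smul_mem _ c ((hmem i).mpr h), fun _ => Submodule.mem_top⟩

theorem nonempty_retract_repV {V : Rep k n} {v : V.V} {N : Submodule k V.V} (hv : v ∉ N)
    (hbot : ∀ i, (repV k n ℓ a b).sub i = ⊥ → V.sub i ≤ N)
    (htop : ∀ i, (repV k n ℓ a b).sub i = ⊤ → v ∈ V.sub i) :
    Nonempty (Retract (repV k n ℓ a b) V) := by
  obtain ⟨φ, hφN, hφv⟩ := LinearMap.exists_extend_of_notMem (0 : N →ₗ[k] k) hv 1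
  refine ⟨⟨ofLinear (V := repV k n ℓ a b) (LinearMap.toSpanSingleton k V.V v)
    fun i (c : k) hc => show c • v ∈ V.sub i from ?_,
    ofLinear (W := repV k n ℓ a b) φ fun i x hx => ?_, hom_ext fun (c : k) => ?_⟩⟩
  · rcases repV_sub_eq_bot_or_eq_top (k := k) (ℓ := ℓ) (a := a) (b := b) i with h | h
    · rw [h] at hc
      exact (show c = 0 from hc) ▸ (zero_smul k v).symm ▸ zero_mem _
    · exact Submodule.smul_mem _ _ (htop i h)
  · rcases repV_sub_eq_bot_or_eq_top (k := k) (ℓ := ℓ) (a := a) (b := b) i with h | h <;> rw [h]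
    · exact LinearMap.congr_fun hφN ⟨x, hbot i h hx⟩
    · exact Submodule.mem_top
  · change φ (c • v) = c
    rw [map_smul, hφv, smul_eq_mul, mul_one]

theorem nonempty_retract_repV_of_mem_level {V : Rep k n} {t : ℕ} {v : V.V} (hv0 : v ≠ 0)
    (ht : t < n) (hvt : v ∈ V.level t) (hbot : ∀ i, t < i → i < n → V.level i = ⊥)
    (ha : v ∈ V.sub .prime ↔ a = 1) (hb : v ∈ V.sub .dprime ↔ b = 1) (hab : a = 1 ∨ b = 1) :
    Nonempty (Retract (repV k n t a b) V) := by
  obtain ⟨N, hvN, h', h''⟩ : ∃ N : Submodule k V.V, v ∉ N ∧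
      (a ≠ 1 → V.sub .prime ≤ N) ∧ (b ≠ 1 → V.sub .dprime ≤ N) := by
    by_cases ha1 : a = 1
    · by_cases hb1 : b = 1
      · exact ⟨⊥, hv0, fun h => absurd ha1 h, fun h => absurd hb1 h⟩
      · exact ⟨V.sub .dprime, mt hb.mp hb1, fun h => absurd ha1 h, fun _ => le_rfl⟩
    · exact ⟨V.sub .prime, mt ha.mp ha1, fun _ => le_rfl, fun h => absurd (hab.resolve_left ha1) h⟩
  refine nonempty_retract_repV hvN ?_ ?_ <;> rintro (⟨i, h1, h2⟩ | _ | _) hi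
  · have hti : ¬ i ≤ t := fun h => bot_ne_top (hi.symm.trans (repV_sub_chain_eq_top_iff.mpr h))
    rw [← level_eq V h1 h2, hbot i (not_le.mp hti) h2]
    exact bot_le
  · exact h' fun h => bot_ne_top (hi.symm.trans (repV_sub_prime_eq_top_iff.mpr h))
  · exact h'' fun h => bot_ne_top (hi.symm.trans (repV_sub_dprime_eq_top_iff.mpr h))
  · rw [← level_eq V h1 h2]
    exact level_anti V (repV_sub_chain_eq_top_iff.mp hi) ht hvt
  · exact ha.mpr (repV_sub_prime_eq_top_iff.mp hi)
  · exact hb.mpr (repV_sub_dprime_eq_top_iff.mp hi)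

end RepV

section RepW

variable {s t : ℕ}

instance : Nontrivial (repW k n s t).V := inferInstanceAs (Nontrivial (k × k))

theorem mem_repW_sub_chain_iff (hst : s ≤ t) {i : ℕ} {h1 : 1 ≤ i} {h2 : i < n} {c d : k} :
    ((c, d) : k × k) ∈ (repW k n s t).sub (.chain i h1 h2) ↔
      (i ≤ s ∨ c = d) ∧ (i ≤ t ∨ c = 0 ∧ d = 0) := by
  change (c, d) ∈ (if i ≤ s then ⊤ else if i ≤ t then Submodule.span k {((1, 1) : k × k)} else ⊥)
    ↔ _
  split_ifs with hs ht
  · simp [hs, hs.trans hst]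
  · simp [hs, ht, Submodule.mem_span_singleton]
  · simp only [Submodule.mem_bot, hs, ht, false_or, Prod.mk_eq_zero]
    exact ⟨fun h => ⟨h.1.trans h.2.symm, h⟩, fun h => h.2⟩

theorem mem_repW_sub_prime_iff {c d : k} :
    ((c, d) : k × k) ∈ (repW k n s t).sub .prime ↔ d = 0 := by
  change (c, d) ∈ Submodule.prod ⊤ ⊥ ↔ _
  simp

theorem mem_repW_sub_dprime_iff {c d : k} :
    ((c, d) : k × k) ∈ (repW k n s t).sub .dprime ↔ c = 0 := by
  change (c, d) ∈ Submodule.prod ⊥ ⊤ ↔ _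
  simp

theorem repW_sub_chain_eq_top_iff (hst : s ≤ t) {i : ℕ} {h1 : 1 ≤ i} {h2 : i < n} :
    (repW k n s t).sub (.chain i h1 h2) = ⊤ ↔ i ≤ s := by
  refine ⟨fun h => ?_, fun h => if_pos h⟩
  have h10 := (mem_repW_sub_chain_iff hst).mp (h.ge (Submodule.mem_top (x := ((1, 0) : k × k))))
  simpa using h10.1

theorem repW_sub_chain_eq_bot_iff (hst : s ≤ t) {i : ℕ} {h1 : 1 ≤ i} {h2 : i < n} :
    (repW k n s t).sub (.chain i h1 h2) = ⊥ ↔ t < i := by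
  refine ⟨fun h => not_le.mp fun hi => ?_, fun h => ?_⟩
  · have h11 := h.le ((mem_repW_sub_chain_iff hst (c := 1) (d := 1)).mpr ⟨.inr rfl, .inl hi⟩)
    exact one_ne_zero (congrArg Prod.fst (show ((1, 1) : k × k) = 0 from h11))
  · exact (if_neg (by omega)).trans (if_neg (by omega))

theorem repW_sub_prime_ne_bot : (repW k n s t).sub .prime ≠ ⊥ := by
  intro h
  have h10 : ((1, 0) : k × k) ∈ (repW k n s t).sub .prime := mem_repW_sub_prime_iff.mpr rfl
  rw [h] at h10
  exact one_ne_zero (congrArg Prod.fst (show ((1, 0) : k × k) = 0 from h10))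

theorem repW_sub_prime_ne_top : (repW k n s t).sub .prime ≠ ⊤ := by
  intro h
  have h01 : ((0, 1) : k × k) ∈ (repW k n s t).sub .prime :=
    h.ge Submodule.mem_top
  exact one_ne_zero (mem_repW_sub_prime_iff.mp h01)

theorem indecomposable_repW (hst : s < t) (ht : t < n) : Indecomposable (repW k n s t) := by
  refine indecomposable_of_forall_eq_smul fun e => ?_
  let f : k × k →ₗ[k] k × k := toLinear e
  have h10 : (f (1, 0)).2 = 0 :=
    mem_repW_sub_prime_iff.mp (toLinear_mem e .prime (mem_repW_sub_prime_iff.mpr rfl))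
  have h01 : (f (0, 1)).1 = 0 :=
    mem_repW_sub_dprime_iff.mp (toLinear_mem e .dprime (mem_repW_sub_dprime_iff.mpr rfl))
  have h11 : (f (1, 1)).1 = (f (1, 1)).2 :=
    ((mem_repW_sub_chain_iff hst.le).mp (toLinear_mem e (.chain t (by omega) ht)
      ((mem_repW_sub_chain_iff hst.le).mpr ⟨.inr rfl, .inl le_rfl⟩))).1.resolve_left (by omega)
  have hsum : f (1, 1) = f (1, 0) + f (0, 1) := by rw [← map_add]; simp
  have hdiag : (f (1, 0)).1 = (f (0, 1)).2 := by
    rw [hsum] at h11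
    simpa [h10, h01] using h11
  refine ⟨(f (1, 0)).1, fun (v : k × k) => ?_⟩
  change f v = (f (1, 0)).1 • v
  have hv : v = v.1 • ((1, 0) : k × k) + v.2 • ((0, 1) : k × k) := by ext <;> simp
  conv_lhs => rw [hv, map_add, map_smul, map_smul]
  ext
  · simp [h01, mul_comm]
  · simp [h10, hdiag, mul_comm]

theorem nonempty_iso_repW {V : Rep k n} {v w : V.V} (hspan : ∀ x, ∃ c d : k, c • v + d • w = x)
    (hmem : ∀ i (c d : k), c • v + d • w ∈ V.sub i ↔ ((c, d) : k × k) ∈ (repW k n s t).sub i) :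
    Nonempty (V ≅ repW k n s t) := by
  let f : k × k →ₗ[k] V.V :=
    (LinearMap.toSpanSingleton k V.V v).coprod (LinearMap.toSpanSingleton k V.V w)
  have hker : ∀ x, f x = 0 → x = 0 := by
    rintro ⟨c, d⟩ (h : c • v + d • w = 0)
    have hc : c = 0 := mem_repW_sub_dprime_iff.mp ((hmem .dprime c d).mp (h ▸ zero_mem _))
    have hd : d = 0 := mem_repW_sub_prime_iff.mp ((hmem .prime c d).mp (h ▸ zero_mem _))
    rw [hc, hd, Prod.mk_zero_zero]
  let e : (k × k) ≃ₗ[k] V.V := LinearEquiv.ofBijective f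
    ⟨(injective_iff_map_eq_zero f).mpr hker, fun x => (hspan x).elim fun c ⟨d, h⟩ => ⟨(c, d), h⟩⟩
  exact ⟨(isoOfLinearEquiv (V := repW k n s t) e fun i (x : k × k) => (hmem i x.1 x.2).symm).symm⟩

theorem nonempty_retract_repW {V : Rep k n} (hst : s < t) (ht : t < n) {x y : V.V}
    (hx' : x ∈ V.sub .prime) (hy'' : y ∈ V.sub .dprime) (hxs : x ∈ V.level s) (hys : y ∈ V.level s)
    (hxy : x + y ∈ V.level t) {φ ψ : V.V →ₗ[k] k} (hφx : φ x = 1)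
    (hφ : ∀ v ∈ V.sub .dprime, φ v = 0) (hψ : ∀ v ∈ V.sub .prime, ψ v = 0)
    (hφψ : ∀ v ∈ V.level (s + 1), φ v = ψ v) (hbot : ∀ i, t < i → i < n → V.level i = ⊥) :
    Nonempty (Retract (repW k n s t) V) := by
  have hψy : ψ y = 1 := by
    have h := hφψ _ (level_anti V hst ht hxy)
    rwa [map_add, map_add, hφx, hφ y hy'', hψ x hx', add_zero, zero_add, eq_comm] at h
  refine ⟨⟨ofLinear (V := repW k n s t)
    ((LinearMap.toSpanSingleton k V.V x).coprod (LinearMap.toSpanSingleton k V.V y)) ?_,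
    ofLinear (W := repW k n s t) (φ.prod ψ) ?_, hom_ext fun ((c, d) : k × k) => ?_⟩⟩
  · rintro (⟨i, h1, h2⟩ | _ | _) ⟨c, d⟩ hcd <;> change c • x + d • y ∈ _
    · obtain ⟨hs, ht'⟩ := (mem_repW_sub_chain_iff hst.le).mp hcd
      rw [← level_eq V h1 h2]
      rcases hs with hs | rfl
      · have hle := level_anti V hs (by omega)
        exact add_mem (Submodule.smul_mem _ _ (hle hxs)) (Submodule.smul_mem _ _ (hle hys))
      · rcases ht' with hi | ⟨rfl, -⟩
        · rw [← smul_add]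
          exact Submodule.smul_mem _ _ (level_anti V hi ht hxy)
        · simp
    · rw [mem_repW_sub_prime_iff.mp hcd, zero_smul, add_zero]
      exact Submodule.smul_mem _ _ hx'
    · rw [mem_repW_sub_dprime_iff.mp hcd, zero_smul, zero_add]
      exact Submodule.smul_mem _ _ hy''
  · rintro (⟨i, h1, h2⟩ | _ | _) v hv
    · rw [← level_eq V h1 h2] at hv
      refine (mem_repW_sub_chain_iff hst.le).mpr ⟨or_iff_not_imp_left.mpr fun hs =>
        hφψ v (level_anti V (by omega) h2 hv), or_iff_not_imp_left.mpr fun hi => ?_⟩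
      rw [hbot i (by omega) h2, Submodule.mem_bot] at hv
      exact ⟨hv ▸ map_zero φ, hv ▸ map_zero ψ⟩
    · exact mem_repW_sub_prime_iff.mpr (hψ v hv)
    · exact mem_repW_sub_dprime_iff.mpr (hφ v hv)
  · change (φ (c • x + d • y), ψ (c • x + d • y)) = (c, d)
    simp [hφx, hψy, hφ y hy'', hψ x hx']

end RepW

section Iso

theorem eq_of_forall_le_iff_le {a b : ℕ} (ha : a < n) (hb : b < n)
    (h : ∀ i, 1 ≤ i → i < n → (i ≤ a ↔ i ≤ b)) : a = b := by
  have ha' := h a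
  have hb' := h b
  omega

theorem eq_of_repV_iso {ℓ ℓ' : ℕ} {a a' b b' : Fin 2} (f : repV k n ℓ a b ≅ repV k n ℓ' a' b')
    (hℓ : ℓ < n) (hℓ' : ℓ' < n) : ℓ = ℓ' ∧ (a = 1 ↔ a' = 1) ∧ (b = 1 ↔ b' = 1) := by
  refine ⟨eq_of_forall_le_iff_le hℓ hℓ' fun i h1 h2 => ?_, ?_, ?_⟩
  · simpa only [repV_sub_chain_eq_top_iff] using sub_eq_top_iff_of_iso f (.chain i h1 h2)
  · simpa only [repV_sub_prime_eq_top_iff] using sub_eq_top_iff_of_iso f .prime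
  · simpa only [repV_sub_dprime_eq_top_iff] using sub_eq_top_iff_of_iso f .dprime

theorem eq_of_repW_iso {s s' t t' : ℕ} (f : repW k n s t ≅ repW k n s' t')
    (hst : s < t) (hst' : s' < t') (ht : t < n) (ht' : t' < n) : s = s' ∧ t = t' := by
  constructor <;> refine eq_of_forall_le_iff_le (n := n) (by omega) (by omega) fun i h1 h2 => ?_
  · simpa only [repW_sub_chain_eq_top_iff hst.le, repW_sub_chain_eq_top_iff hst'.le] using
      sub_eq_top_iff_of_iso f (.chain i h1 h2)
  · simpa only [repW_sub_chain_eq_bot_iff hst.le, repW_sub_chain_eq_bot_iff hst'.le, not_lt] using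
      not_congr (sub_eq_bot_iff_of_iso f (.chain i h1 h2))

theorem isEmpty_repV_iso_repW {ℓ s t : ℕ} {a b : Fin 2} :
    IsEmpty (repV k n ℓ a b ≅ repW k n s t) := by
  refine ⟨fun f => ?_⟩
  rcases repV_sub_eq_bot_or_eq_top (k := k) (ℓ := ℓ) (a := a) (b := b) .prime with h | h
  · exact repW_sub_prime_ne_bot ((sub_eq_bot_iff_of_iso f .prime).mp h)
  · exact repW_sub_prime_ne_top ((sub_eq_top_iff_of_iso f .prime).mp h)

end Iso

section Retract

theorem exists_last_level (hn : 1 ≤ n) (V : Rep k n) [Nontrivial V.V] :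
    ∃ t < n, V.level t ≠ ⊥ ∧ ∀ i, t < i → i < n → V.level i = ⊥ := by
  classical
  have h0 : V.level 0 ≠ ⊥ := level_zero V ▸ top_ne_bot
  refine ⟨Nat.findGreatest (fun i => V.level i ≠ ⊥) (n - 1),
    (Nat.findGreatest_le _).trans_lt (by omega),
    Nat.findGreatest_spec (P := fun i => V.level i ≠ ⊥) (Nat.zero_le _) h0,
    fun i hti hi => not_not.mp (Nat.findGreatest_is_greatest hti (by omega))⟩

theorem succ_lt_of_not_level_le_prime {V : Rep k n} (hV : restricted k n V) {t : ℕ} (ht : t < n)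
    (h : ¬ V.level t ≤ V.sub .prime) : t + 1 < n := by
  by_contra hn
  obtain rfl : t = n - 1 := by omega
  exact h hV.1

theorem exists_last_level_sub_mem_dprime {V : Rep k n} (hV : V.sub .prime ⊔ V.sub .dprime = ⊤)
    {t : ℕ} (hd' : Disjoint (V.level t) (V.sub .prime))
    (hd'' : Disjoint (V.level t) (V.sub .dprime)) {x : V.V} (hx : x ∈ V.level t) (hx0 : x ≠ 0) :
    ∃ s < t, (∃ y ∈ V.sub .prime, y ∈ V.level s ∧ x - y ∈ V.sub .dprime) ∧
      ¬ ∃ y ∈ V.sub .prime, y ∈ V.level (s + 1) ∧ x - y ∈ V.sub .dprime := by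
  by_contra! hstep
  have hall : ∀ s ≤ t, ∃ y ∈ V.sub .prime, y ∈ V.level s ∧ x - y ∈ V.sub .dprime := by
    intro s
    induction s with
    | zero =>
      intro _
      obtain ⟨y, hy, z, hz, hyz⟩ := Submodule.mem_sup.mp (hV.ge (Submodule.mem_top (x := x)))
      exact ⟨y, hy, level_zero V ▸ Submodule.mem_top, by rwa [← hyz, add_sub_cancel_left]⟩
    | succ s ih => exact fun hs => hstep s hs (ih (by omega))
  obtain ⟨y, hy', hyt, hxy⟩ := hall t le_rfl
  obtain rfl := Submodule.disjoint_def.mp hd' y hyt hy'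
  exact hx0 (Submodule.disjoint_def.mp hd'' x hx (by simpa using hxy))

theorem exists_retract_repW {V : Rep k n} (hV : V.sub .prime ⊔ V.sub .dprime = ⊤) {t : ℕ}
    (ht : t < n) (hd' : Disjoint (V.level t) (V.sub .prime))
    (hd'' : Disjoint (V.level t) (V.sub .dprime)) (ht0 : V.level t ≠ ⊥)
    (hbot : ∀ i, t < i → i < n → V.level i = ⊥) :
    ∃ s < t, Nonempty (Retract (repW k n s t) V) := by
  obtain ⟨x, hx, hx0⟩ := Submodule.exists_mem_ne_zero_of_ne_bot ht0
  obtain ⟨s, hst, ⟨y, hy', hys, hxy⟩, hmax⟩ := exists_last_level_sub_mem_dprime hV hd' hd'' hx hx0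
  have hy : y ∉ (V.sub .prime ⊓ V.sub .dprime) ⊔ V.level (s + 1) := fun hmem => by
    obtain ⟨a, ⟨ha', ha''⟩, b, hb, rfl⟩ := Submodule.mem_sup.mp hmem
    refine hmax ⟨b, ?_, hb, ?_⟩
    · simpa using sub_mem hy' ha'
    · convert add_mem hxy ha'' using 1
      abel
  -- By maximality of `s`, some `θ` with `θ y = 1` vanishes on `V' ∩ V''` and on `V^{s+1}`. Take
  -- `φ = θ` on `V'` and `φ = 0` on `V''`: then `ψ = φ - θ` vanishes on `V'` and equals `φ` on
  -- `V^{s+1}`.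
  obtain ⟨θ, hθ, hθy⟩ := LinearMap.exists_extend_of_notMem (0 : _ →ₗ[k] k) hy 1
  have hθ0 : ∀ v ∈ (V.sub .prime ⊓ V.sub .dprime) ⊔ V.level (s + 1), θ v = 0 :=
    fun v hv => LinearMap.congr_fun hθ ⟨v, hv⟩
  obtain ⟨φ, hφ', hφ''⟩ := exists_linearMap_eqOn_of_sup_eq_top hV (f := θ) (g := 0)
    fun v hv => hθ0 v (Submodule.mem_sup_left hv)
  refine ⟨s, hst, nonempty_retract_repW (ψ := φ - θ) hst ht hy' hxy hys
    (sub_mem (level_anti V hst.le ht hx) hys) (by rwa [add_sub_cancel])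
    ((hφ' hy').trans hθy) hφ'' (fun v hv => sub_eq_zero.mpr (hφ' hv)) (fun v hv => ?_) hbot⟩
  rw [LinearMap.sub_apply, hθ0 v (Submodule.mem_sup_right hv), sub_zero]

end Retract

end Rep

namespace SubPair.Index

variable (k : Type u) [Field k] {n : ℕ}

/-- The representation to which `F` sends the pair with the given index: `V_{ℓ-1,1,0}`,
`V_{ℓ-1,1,1}` and `V_{ℓ-2,0,1}` for the pickets `P^ℓ_0`, `P^ℓ_1` and `P^ℓ_2`, and `W_{s-1,t-2}` for
the pair `Q^t_s`. -/
def rep : Index n → Rep k n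
  | .picket ℓ m _ _ _ _ =>
    Rep.repV k n (ℓ - max m 1) (if m ≤ 1 then 1 else 0) (if 1 ≤ m then 1 else 0)
  | .pairQ t s _ _ _ => Rep.repW k n (s - 1) (t - 2)

theorem indecomposable_rep (x : Index n) : Indecomposable (x.rep k) := by
  cases x with
  | picket => exact Rep.indecomposable_repV _ _ _
  | pairQ t s _ hst ht => exact Rep.indecomposable_repW hst (by omega)

variable {k}

theorem eq_of_rep_iso : ∀ {x y : Index n}, (x.rep k ≅ y.rep k) → x = y
  | .picket ℓ m _ _ _ _, .picket ℓ' m' _ _ _ _, f => by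
    obtain ⟨hℓ, hprime, hdprime⟩ := Rep.eq_of_repV_iso f (by omega) (by omega)
    simp only [ite_eq_left_iff, zero_ne_one, imp_false, not_not] at hprime hdprime
    obtain rfl : m = m' := by omega
    obtain rfl : ℓ = ℓ' := by omega
    rfl
  | .pairQ t s _ hst _, .pairQ t' s' _ hst' _, f => by
    obtain ⟨hs, ht⟩ := Rep.eq_of_repW_iso f hst hst' (by omega) (by omega)
    obtain rfl : s = s' := by omega
    obtain rfl : t = t' := by omega
    rfl
  | .picket .., .pairQ .., f => (Rep.isEmpty_repV_iso_repW.false f).elim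
  | .pairQ .., .picket .., f => (Rep.isEmpty_repV_iso_repW.false f.symm).elim

theorem exists_retract_rep_of_mem_level {V : Rep k n} (hV : Rep.restricted k n V) {t : ℕ} {v : V.V}
    (hv0 : v ≠ 0) (ht : t < n) (hvt : v ∈ V.level t)
    (hbot : ∀ i, t < i → i < n → V.level i = ⊥) (hv : v ∈ V.sub .prime ∨ v ∈ V.sub .dprime) :
    ∃ x : Index n, Nonempty (Retract (x.rep k) V) := by
  by_cases h' : v ∈ V.sub .prime
  · by_cases h'' : v ∈ V.sub .dprime
    · exact ⟨.picket (t + 1) 1 (by omega) ht (by omega) (by omega),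
        Rep.nonempty_retract_repV_of_mem_level hv0 ht hvt hbot (by simp [h']) (by simp [h''])
          (by simp)⟩
    · exact ⟨.picket (t + 1) 0 (by omega) ht (by omega) (by omega),
        Rep.nonempty_retract_repV_of_mem_level hv0 ht hvt hbot (by simp [h']) (by simp [h''])
          (by simp)⟩
  · have ht' := Rep.succ_lt_of_not_level_le_prime hV ht fun hle => h' (hle hvt)
    have h'' := hv.resolve_left h'
    exact ⟨.picket (t + 2) 2 (by omega) ht' (by omega) le_rfl,
      Rep.nonempty_retract_repV_of_mem_level hv0 ht hvt hbot (by simp [h']) (by simp [h''])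
        (by simp)⟩

theorem exists_retract_rep (hn : 1 ≤ n) {V : Rep k n} (hV : Rep.restricted k n V)
    (h0 : ¬ IsZero V) : ∃ x : Index n, Nonempty (Retract (x.rep k) V) := by
  have : Nontrivial V.V := not_subsingleton_iff_nontrivial.mp (mt Rep.isZero_iff.mpr h0)
  obtain ⟨t, ht, ht0, hbot⟩ := Rep.exists_last_level hn V
  by_cases hd' : Disjoint (V.level t) (V.sub .prime)
  · by_cases hd'' : Disjoint (V.level t) (V.sub .dprime)
    · obtain ⟨s, hst, hW⟩ := Rep.exists_retract_repW hV.2 ht hd' hd'' ht0 hbot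
      have ht' := Rep.succ_lt_of_not_level_le_prime hV ht
        fun hle => ht0 (disjoint_self.mp (hd'.mono_right hle))
      exact ⟨.pairQ (t + 2) (s + 1) (by omega) hst ht', hW⟩
    · obtain ⟨v, ⟨hvt, hv⟩, hv0⟩ :=
        Submodule.exists_mem_ne_zero_of_ne_bot (mt disjoint_iff.mpr hd'')
      exact exists_retract_rep_of_mem_level hV hv0 ht hvt hbot (.inr hv)
  · obtain ⟨v, ⟨hvt, hv⟩, hv0⟩ := Submodule.exists_mem_ne_zero_of_ne_bot (mt disjoint_iff.mpr hd')
    exact exists_retract_rep_of_mem_level hV hv0 ht hvt hbot (.inl hv)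

end SubPair.Index

theorem Rep.restricted_le_of_biprod {k : Type u} [Field k] {n : ℕ} (hn : 1 ≤ n)
    (P : ObjectProperty (Rep k n)) [P.IsClosedUnderIsomorphisms]
    (hzero : ∀ V, IsZero V → P V) (hrep : ∀ x : SubPair.Index n, P (x.rep k))
    (hbiprod : ∀ V W, P V → P W → P (V ⊞ W)) : Rep.restricted k n ≤ P := by
  intro V hV
  induction h : Module.finrank k V.V using Nat.strong_induction_on generalizing V with
  | _ d ih =>
  subst h
  by_cases h0 : IsZero V
  · exact hzero V h0
  · obtain ⟨x, ⟨r⟩⟩ := SubPair.Index.exists_retract_rep hn hV h0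
    obtain ⟨K, hK, ⟨e⟩⟩ := Rep.exists_iso_biprod_of_retract r (x.indecomposable_rep k).1
    have hKV : Rep.restricted k n K := (Rep.restricted k n).prop_of_retract
      ⟨biprod.inl ≫ e.inv, e.hom ≫ biprod.fst, by simp⟩ hV
    exact P.prop_of_iso e.symm (hbiprod _ _ (ih _ hK K hKV rfl) (hrep x))

/-! ### The functor `F` is additive and reflects zero objects -/

section Functor

variable {Λ : Type u} [CommRing Λ] [IsLocalRing Λ] {n : ℕ}

namespace SubPair

theorem isZero_iff {m : ℕ} {X : SubPair Λ m} : IsZero X ↔ Subsingleton X.B := by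
  rw [IsZero.iff_id_eq_zero]
  refine ⟨fun h => ?_, fun _ => Subtype.ext (LinearMap.ext fun _ => Subsingleton.elim _ _)⟩
  exact subsingleton_of_forall_eq 0 fun b => congrArg (fun f : homs X X => f.1 b) h

theorem minus_le (X : SubPair Λ 2) : X.minus ≤ X.A :=
  Submodule.smul_le_right

theorem minus_le_plus (X : SubPair Λ 2) : X.minus ≤ X.plus :=
  X.minus_le.trans le_sup_left

/-- The residue class map `A⁺ → A⁺ / A⁻`. -/
def toTotal (X : SubPair Λ 2) : X.plus →ₗ[Λ] X.Total :=
  (X.minus.submoduleOf X.plus).mkQ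

theorem toTotal_surjective (X : SubPair Λ 2) : Function.Surjective X.toTotal :=
  Submodule.mkQ_surjective _

variable {X : SubPair Λ 2}

theorem toTotal_eq_zero_iff {x : X.plus} : X.toTotal x = 0 ↔ (x : X.B) ∈ X.minus :=
  Submodule.Quotient.mk_eq_zero _

theorem residue_smul_toTotal (c : Λ) (x : X.plus) :
    residue Λ c • X.toTotal x = X.toTotal (c • x) :=
  (algebraMap_smul (ResidueField Λ) c (X.toTotal x)).trans (map_smul X.toTotal c x).symm

theorem toTotal_mem_tilde_iff {C : Submodule Λ X.B} {x : X.plus} :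
    X.toTotal x ∈ X.tilde C ↔ (x : X.B) ∈ C ⊔ X.minus := by
  constructor
  · rintro ⟨y, hy, hyx⟩
    have hxy : ((x - y : X.plus) : X.B) ∈ X.minus :=
      toTotal_eq_zero_iff.mp <| by rw [map_sub, sub_eq_zero]; exact hyx.symm
    exact Submodule.mem_sup.mpr ⟨y, hy, _, hxy, add_sub_cancel (y : X.B) x⟩
  · intro h
    obtain ⟨c, hc, m, hm, hx⟩ := Submodule.mem_sup.mp h
    let z : X.plus := ⟨m, X.minus_le_plus hm⟩
    have hxz : ((x - z : X.plus) : X.B) ∈ C := by rwa [show ((x - z : X.plus) : X.B) = c from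
      sub_eq_of_eq_add hx.symm]
    have hz : X.toTotal z = 0 := toTotal_eq_zero_iff.mpr hm
    exact ⟨x - z, hxz, (map_sub X.toTotal x z).trans (by rw [hz, sub_zero])⟩

end SubPair

theorem le_soc_iff {B : Type u} [AddCommGroup B] [Module Λ B] {N : Submodule Λ B} :
    N ≤ SubPair.soc Λ B ↔ maximalIdeal Λ • N = ⊥ := by
  rw [eq_bot_iff, Submodule.smul_le]
  simp only [SetLike.le_def, Submodule.mem_torsionBySet_iff, Subtype.forall, SetLike.mem_coe,
    Submodule.mem_bot]
  exact ⟨fun h r hr x hx => h hx r hr, fun h x hx r hr => h r hr x hx⟩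

theorem subsingleton_of_soc_eq_bot {B : Type u} [AddCommGroup B] [Module Λ B]
    (hnil : IsNilpotent (maximalIdeal Λ)) (h : SubPair.soc Λ B = ⊥) : Subsingleton B := by
  obtain ⟨n, hn⟩ := hnil
  have top_eq_bot (j : ℕ) :
      maximalIdeal Λ ^ j • (⊤ : Submodule Λ B) = ⊥ → (⊤ : Submodule Λ B) = ⊥ := by
    induction j with
    | zero => simp
    | succ j ih =>
      intro hj
      rw [pow_succ', mul_smul, ← le_soc_iff, h, le_bot_iff] at hj
      exact ih hj
  have h0 : (⊤ : Submodule Λ B) = ⊥ :=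
    top_eq_bot n (by rw [hn, Submodule.zero_eq_bot, Submodule.bot_smul])
  exact (Submodule.subsingleton_iff Λ).mp (subsingleton_of_bot_eq_top h0.symm)

instance (hΛ : IsUniserialOfLength Λ n) : (F hΛ).Additive where
  map_add {X Y f g} := Subtype.ext <| LinearMap.ext fun x => by
    obtain ⟨x, rfl⟩ := X.toTotal_surjective x
    rfl

theorem isZero_of_isZero_F_obj (hΛ : IsUniserialOfLength Λ n) (X : SubPair Λ 2)
    (h : IsZero ((F hΛ).obj X)) : IsZero X := by
  have : Subsingleton X.Total := Rep.isZero_iff.mp h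
  have plus_le_minus : X.plus ≤ X.minus := fun x hx =>
    SubPair.toTotal_eq_zero_iff.mp (Subsingleton.elim (X.toTotal ⟨x, hx⟩) 0)
  have smul_A : maximalIdeal Λ • X.A = X.A :=
    le_antisymm X.minus_le (le_sup_left.trans plus_le_minus)
  have A_eq_bot : X.A = ⊥ := by rw [← X.bounded, pow_two, mul_smul, smul_A, smul_A]
  have soc_eq_bot : SubPair.soc Λ X.B = ⊥ :=
    le_bot_iff.mp (A_eq_bot ▸ le_sup_right.trans (plus_le_minus.trans X.minus_le))
  exact SubPair.isZero_iff.mpr (subsingleton_of_soc_eq_bot ⟨n, hΛ.pow_eq_bot⟩ soc_eq_bot)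

end Functor

/-! ### Pickets -/

section QuotPow

variable {R : Type u} [CommRing R] {p : R} {ℓ : ℕ}

/-- The submodule generated by `p ^ j` of `R / (p ^ ℓ)`. -/
def quotPow (p : R) (ℓ j : ℕ) : Submodule R (R ⧸ Ideal.span {p ^ ℓ}) :=
  Submodule.span R {Ideal.Quotient.mk (Ideal.span {p ^ ℓ}) (p ^ j)}

theorem mk_mem_quotPow_iff {j : ℕ} {y : R} :
    Ideal.Quotient.mk (Ideal.span {p ^ ℓ}) y ∈ quotPow p ℓ j ↔ p ^ min j ℓ ∣ y := by
  have hmem : Ideal.Quotient.mk (Ideal.span {p ^ ℓ}) y ∈ quotPow p ℓ j ↔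
      y ∈ Ideal.span {p ^ j} ⊔ Ideal.span {p ^ ℓ} := by
    rw [quotPow, Submodule.mem_span_singleton, Ideal.mem_span_singleton_sup]
    simp only [Algebra.smul_def, Ideal.Quotient.algebraMap_eq, ← map_mul, Ideal.Quotient.eq]
    refine exists_congr fun c => ?_
    rw [← neg_mem_iff, neg_sub]
    exact ⟨fun h => ⟨_, h, add_sub_cancel _ _⟩, fun ⟨b, hb, h⟩ => by rwa [← h, add_sub_cancel_left]⟩
  rw [hmem]
  rcases le_total j ℓ with h | h
  · rw [min_eq_left h, ← Ideal.mem_span_singleton,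
      sup_eq_left.mpr (Ideal.span_singleton_le_span_singleton.mpr (pow_dvd_pow p h))]
  · rw [min_eq_right h, ← Ideal.mem_span_singleton,
      sup_eq_right.mpr (Ideal.span_singleton_le_span_singleton.mpr (pow_dvd_pow p h))]

theorem quotPow_antitone : Antitone (quotPow p ℓ) := fun i j h => by
  rw [quotPow, Submodule.span_singleton_le_iff_mem, mk_mem_quotPow_iff]
  exact pow_dvd_pow p ((min_le_left i ℓ).trans h)

theorem quotPow_sup (i j : ℕ) : quotPow p ℓ i ⊔ quotPow p ℓ j = quotPow p ℓ (min i j) := by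
  rcases le_total i j with h | h
  · rw [min_eq_left h, sup_eq_left.mpr (quotPow_antitone h)]
  · rw [min_eq_right h, sup_eq_right.mpr (quotPow_antitone h)]

theorem quotPow_zero : quotPow p ℓ 0 = ⊤ := by
  refine eq_top_iff.mpr fun x _ => ?_
  obtain ⟨y, rfl⟩ := Ideal.Quotient.mk_surjective x
  rw [mk_mem_quotPow_iff, Nat.zero_min, pow_zero]
  exact one_dvd y

theorem span_pow_smul_quotPow (i j : ℕ) :
    Ideal.span {p} ^ i • quotPow p ℓ j = quotPow p ℓ (i + j) := by
  rw [Ideal.span_singleton_pow, Submodule.ideal_span_singleton_smul, quotPow, quotPow,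
    Submodule.smul_span, Set.smul_set_singleton, pow_add]
  rfl

end QuotPow

section Picket

variable {Λ : Type u} [CommRing Λ] [IsLocalRing Λ] {n ℓ : ℕ} {p : Λ}

theorem mem_soc_iff {B : Type u} [AddCommGroup B] [Module Λ B]
    (hp : maximalIdeal Λ = Ideal.span {p}) {x : B} : x ∈ SubPair.soc Λ B ↔ p • x = 0 := by
  rw [SubPair.soc, hp, Submodule.torsionBySet_span_singleton_eq, Submodule.mem_torsionBy_iff]

theorem radPow_quotient (hp : maximalIdeal Λ = Ideal.span {p}) (i : ℕ) :
    SubPair.radPow Λ (Λ ⧸ Ideal.span {p ^ ℓ}) i = quotPow p ℓ i := by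
  rw [SubPair.radPow, hp, ← quotPow_zero, span_pow_smul_quotPow, add_zero]

theorem soc_quotient (hΛ : IsUniserialOfLength Λ n) (hp : maximalIdeal Λ = Ideal.span {p})
    (hn : ℓ ≤ n) :
    SubPair.soc Λ (Λ ⧸ Ideal.span {p ^ ℓ}) = quotPow p ℓ (ℓ - 1) := by
  ext x
  obtain ⟨y, rfl⟩ := Ideal.Quotient.mk_surjective x
  have hdvd := hΛ.pow_dvd_mul_pow_iff hp (i := 1) hn (a := y)
  rw [pow_one, mul_comm] at hdvd
  rw [mem_soc_iff hp, mk_mem_quotPow_iff, min_eq_left (Nat.sub_le ℓ 1), ← hdvd,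
    Algebra.smul_def, Ideal.Quotient.algebraMap_eq, ← map_mul, Ideal.Quotient.eq_zero_iff_mem,
    Ideal.mem_span_singleton]

theorem mk_mul_pow_mem_quotPow_iff (hΛ : IsUniserialOfLength Λ n)
    (hp : maximalIdeal Λ = Ideal.span {p}) (hn : ℓ ≤ n) {j q : ℕ} (hj : min j ℓ ≤ q + 1)
    (hq : q < ℓ) {c : Λ} :
    Ideal.Quotient.mk (Ideal.span {p ^ ℓ}) (c * p ^ q) ∈ quotPow p ℓ j ↔
      j ≤ q ∨ residue Λ c = 0 := by
  rw [mk_mem_quotPow_iff, hΛ.pow_dvd_mul_pow_iff hp ((min_le_right j ℓ).trans hn),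
    residue_eq_zero_iff, hp, Ideal.mem_span_singleton]
  rcases le_or_gt j q with h | h
  · simp [h, Nat.sub_eq_zero_of_le ((min_le_left j ℓ).trans h)]
  · rw [show min j ℓ - q = 1 by omega, pow_one, or_iff_right h.not_ge]

namespace SubPair

variable {m : ℕ} (hp : maximalIdeal Λ = Ideal.span {p}) (hm : m ≤ 2)

theorem minus_picket : (picket hp ℓ m hm).minus = quotPow p ℓ (1 + (ℓ - m)) := by
  have h := span_pow_smul_quotPow (p := p) (ℓ := ℓ) 1 (ℓ - m)
  rw [pow_one, ← hp] at h
  exact h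

theorem plus_picket (hΛ : IsUniserialOfLength Λ n) (hn : ℓ ≤ n) :
    (picket hp ℓ m hm).plus = quotPow p ℓ (ℓ - max m 1) := by
  have h := quotPow_sup (p := p) (ℓ := ℓ) (ℓ - m) (ℓ - 1)
  rw [← soc_quotient hΛ hp hn, show min (ℓ - m) (ℓ - 1) = ℓ - max m 1 by omega] at h
  exact h

end SubPair

theorem nonempty_F_obj_iso_repV (hΛ : IsUniserialOfLength Λ n) {X : SubPair Λ 2} {x : X.B}
    {a b : Fin 2} (hx : x ∉ X.minus) (hplus : X.plus = Submodule.span Λ {x})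
    (hmem : ∀ i : Poset n, x ∈ X.source i ⊔ X.minus ↔
      (Rep.repV (ResidueField Λ) n ℓ a b).sub i = ⊤) :
    Nonempty ((F hΛ).obj X ≅ Rep.repV (ResidueField Λ) n ℓ a b) := by
  let v : X.plus := ⟨x, hplus ▸ Submodule.mem_span_singleton_self x⟩
  refine Rep.nonempty_iso_repV (v := X.toTotal v) (mt SubPair.toTotal_eq_zero_iff.mp hx)
    (fun y => ?_) fun i => SubPair.toTotal_mem_tilde_iff.trans (hmem i)
  obtain ⟨y, rfl⟩ := X.toTotal_surjective y
  obtain ⟨c, hc⟩ := Submodule.mem_span_singleton.mp (hplus.le y.2)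
  exact ⟨residue Λ c, (SubPair.residue_smul_toTotal c v).trans (congrArg _ (Subtype.ext hc))⟩

theorem nonempty_F_picket_iso (hΛ : IsUniserialOfLength Λ n)
    (hp : maximalIdeal Λ = Ideal.span {p}) {m : ℕ} (h1 : 1 ≤ ℓ) (hn : ℓ ≤ n) (hmℓ : m ≤ ℓ)
    (hm : m ≤ 2) : Nonempty ((F hΛ).obj (SubPair.picket hp ℓ m hm) ≅
      Rep.repV (ResidueField Λ) n (ℓ - max m 1) (if m ≤ 1 then 1 else 0)
        (if 1 ≤ m then 1 else 0)) := by
  have hminus := SubPair.minus_picket hp hm (ℓ := ℓ)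
  have pow_mem (j : ℕ) (hj : min j ℓ ≤ ℓ - max m 1 + 1) : Ideal.Quotient.mk
      (Ideal.span {p ^ ℓ}) (p ^ (ℓ - max m 1)) ∈ quotPow p ℓ j ↔ j ≤ ℓ - max m 1 := by
    have h := mk_mul_pow_mem_quotPow_iff hΛ hp hn hj (by omega) (c := 1)
    rwa [one_mul, map_one, or_iff_left one_ne_zero] at h
  have mem_sup_minus {N : Submodule Λ (Λ ⧸ Ideal.span {p ^ ℓ})} {j : ℕ} (hN : N = quotPow p ℓ j) :
      Ideal.Quotient.mk (Ideal.span {p ^ ℓ}) (p ^ (ℓ - max m 1)) ∈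
        N ⊔ (SubPair.picket hp ℓ m hm).minus ↔ j ≤ ℓ - max m 1 := by
    rw [hminus, hN, quotPow_sup, pow_mem _ (by omega)]
    omega
  refine nonempty_F_obj_iso_repV hΛ (fun h => ?_) (SubPair.plus_picket hp hm hΛ hn) ?_
  · have := (pow_mem _ (by omega)).mp (hminus.le h)
    omega
  · rintro (⟨i, hi1, hi2⟩ | _ | _)
    · exact (mem_sup_minus (radPow_quotient hp i)).trans Rep.repV_sub_chain_eq_top_iff.symm
    · refine (mem_sup_minus (soc_quotient hΛ hp hn)).trans ?_
      rw [Rep.repV_sub_prime_eq_top_iff, ite_eq_left_iff]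
      simp only [zero_ne_one, imp_false, not_not]
      omega
    · refine (mem_sup_minus (j := ℓ - m) rfl).trans ?_
      rw [Rep.repV_sub_dprime_eq_top_iff, ite_eq_left_iff]
      simp only [zero_ne_one, imp_false, not_not]
      omega

end Picket

/-! ### The pairs `Q^t_s` -/

section PairQ

variable {Λ : Type u} [CommRing Λ] [IsLocalRing Λ] {n : ℕ} {p : Λ}

section Prod

variable (B D : Type u) [AddCommGroup B] [AddCommGroup D] [Module Λ B] [Module Λ D]

theorem soc_prod : SubPair.soc Λ (B × D) = (SubPair.soc Λ B).prod (SubPair.soc Λ D) := by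
  ext ⟨b, d⟩
  simp only [Submodule.mem_torsionBySet_iff, Submodule.mem_prod, Prod.smul_mk, Prod.mk_eq_zero,
    forall_and]

theorem radPow_prod (i : ℕ) :
    SubPair.radPow Λ (B × D) i = (SubPair.radPow Λ B i).prod (SubPair.radPow Λ D i) := by
  refine le_antisymm (fun x hx => ⟨SubPair.radPow_map (LinearMap.fst Λ B D) i hx,
    SubPair.radPow_map (LinearMap.snd Λ B D) i hx⟩) ?_
  rw [LinearMap.prod_eq_sup_map]
  exact sup_le (Submodule.map_le_iff_le_comap.mpr (SubPair.radPow_map (LinearMap.inl Λ B D) i))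
    (Submodule.map_le_iff_le_comap.mpr (SubPair.radPow_map (LinearMap.inr Λ B D) i))

end Prod

theorem quotPow_prod_le {R : Type u} [CommRing R] {p : R} {t s : ℕ} (i j : ℕ) :
    (quotPow p t i).prod (quotPow p s j) ≤
      Submodule.span R {(0, -Ideal.Quotient.mk (Ideal.span {p ^ s}) (p ^ j))} ⊔
        (quotPow p t i).prod ⊥ := by
  rintro ⟨a, b⟩ ⟨ha, hb⟩
  obtain ⟨c, rfl⟩ := Submodule.mem_span_singleton.mp hb
  refine Submodule.mem_sup.mpr ⟨_, Submodule.smul_mem _ (-c) (Submodule.mem_span_singleton_self _),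
    (a, 0), ⟨ha, zero_mem ⊥⟩, ?_⟩
  ext <;> simp

theorem nonempty_F_obj_iso_repW (hΛ : IsUniserialOfLength Λ n) {X : SubPair Λ 2} {x y : X.B}
    {s t : ℕ} (hx : x ∈ X.plus) (hy : y ∈ X.plus)
    (hplus : X.plus ≤ Submodule.span Λ {x, y} ⊔ X.minus)
    (hmem : ∀ (i : Poset n) (c d : Λ), c • x + d • y ∈ X.source i ⊔ X.minus ↔
      ((residue Λ c, residue Λ d) : ResidueField Λ × ResidueField Λ) ∈
        (Rep.repW (ResidueField Λ) n s t).sub i) :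
    Nonempty ((F hΛ).obj X ≅ Rep.repW (ResidueField Λ) n s t) := by
  let v : X.plus := ⟨x, hx⟩
  let w : X.plus := ⟨y, hy⟩
  have smul_add_smul (c d : Λ) : residue Λ c • X.toTotal v + residue Λ d • X.toTotal w =
      X.toTotal (c • v + d • w) := by
    rw [SubPair.residue_smul_toTotal, SubPair.residue_smul_toTotal, map_add]
  refine Rep.nonempty_iso_repW (v := X.toTotal v) (w := X.toTotal w) (fun z => ?_) fun i c d => ?_
  · obtain ⟨z, rfl⟩ := X.toTotal_surjective z
    obtain ⟨_, hcd, m, hm, hz⟩ := Submodule.mem_sup.mp (hplus z.2)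
    obtain ⟨c, d, rfl⟩ := Submodule.mem_span_pair.mp hcd
    refine ⟨residue Λ c, residue Λ d, (smul_add_smul c d).trans (sub_eq_zero.mp ?_)⟩
    rw [← map_sub, ← neg_eq_zero, ← map_neg, neg_sub, SubPair.toTotal_eq_zero_iff]
    rwa [show ((z - (c • v + d • w) : X.plus) : X.B) = m from sub_eq_of_eq_add' hz.symm]
  · obtain ⟨c, rfl⟩ := residue_surjective c
    obtain ⟨d, rfl⟩ := residue_surjective d
    rw [← hmem i c d]
    exact (smul_add_smul c d).symm ▸ SubPair.toTotal_mem_tilde_iff (x := c • v + d • w)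

namespace SubPair

variable (hp : maximalIdeal Λ = Ideal.span {p}) {t s : ℕ}

theorem minus_pairQ (ht2 : 2 ≤ t) (hs : 1 ≤ s) :
    (pairQ hp t s).minus = (quotPow p t (t - 1)).prod ⊥ := by
  have hgen : p • ((Ideal.Quotient.mk (Ideal.span {p ^ t}) (p ^ (t - 2)),
      Ideal.Quotient.mk (Ideal.span {p ^ s}) (p ^ (s - 1))) : _ × _) =
      LinearMap.inl Λ _ _ (Ideal.Quotient.mk (Ideal.span {p ^ t}) (p ^ (t - 1))) := by
    rw [Prod.smul_mk, LinearMap.inl_apply]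
    simp only [Algebra.smul_def, Ideal.Quotient.algebraMap_eq, ← map_mul, ← pow_succ']
    rw [show t - 2 + 1 = t - 1 by omega, Nat.sub_add_cancel hs,
      Ideal.Quotient.eq_zero_iff_mem.mpr (Ideal.mem_span_singleton_self (p ^ s))]
  rw [← Submodule.map_inl, quotPow, Submodule.map_span, Set.image_singleton, ← hgen,
    ← Set.smul_set_singleton, ← Submodule.smul_span, ← Submodule.ideal_span_singleton_smul, ← hp]
  rfl

theorem soc_pairQ (hΛ : IsUniserialOfLength Λ n) (ht : t ≤ n) (hs : s ≤ n) :
    soc Λ (pairQ hp t s).B = (quotPow p t (t - 1)).prod (quotPow p s (s - 1)) := by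
  rw [← soc_quotient hΛ hp ht, ← soc_quotient hΛ hp hs]
  exact soc_prod _ _

theorem plus_pairQ_le (hΛ : IsUniserialOfLength Λ n) (ht : t ≤ n) (ht2 : 2 ≤ t) (hs : 1 ≤ s)
    (hsn : s ≤ n) :
    (pairQ hp t s).plus ≤
      Submodule.span Λ {(0, -Ideal.Quotient.mk (Ideal.span {p ^ s}) (p ^ (s - 1))),
        (Ideal.Quotient.mk (Ideal.span {p ^ t}) (p ^ (t - 2)),
          Ideal.Quotient.mk (Ideal.span {p ^ s}) (p ^ (s - 1)))} ⊔ (pairQ hp t s).minus := by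
  refine sup_le (le_sup_of_le_left (Submodule.span_mono (Set.subset_insert _ _))) ?_
  rw [soc_pairQ hp hΛ ht hsn, minus_pairQ hp ht2 hs]
  exact (quotPow_prod_le _ _).trans (sup_le_sup_right
    (Submodule.span_mono (Set.singleton_subset_iff.mpr (Set.mem_insert _ _))) _)

theorem radPow_sup_minus_pairQ (ht2 : 2 ≤ t) (hs : 1 ≤ s) (i : ℕ) :
    radPow Λ (pairQ hp t s).B i ⊔ (pairQ hp t s).minus =
      (quotPow p t (min i (t - 1))).prod (quotPow p s i) := by
  rw [minus_pairQ hp ht2 hs]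
  refine (congrArg (· ⊔ _) (radPow_prod _ _ _)).trans ?_
  exact (Submodule.prod_sup_prod ..).trans
    (by rw [radPow_quotient hp, radPow_quotient hp, quotPow_sup, sup_bot_eq])

theorem mk_zero_mem_A_pairQ_iff (hΛ : IsUniserialOfLength Λ n) (ht : t ≤ n) (ht2 : 2 ≤ t)
    (hs : 1 ≤ s) (hsn : s ≤ n) {c : Λ} :
    ((0, Ideal.Quotient.mk (Ideal.span {p ^ s}) (c * p ^ (s - 1))) :
      (Λ ⧸ Ideal.span {p ^ t}) × (Λ ⧸ Ideal.span {p ^ s})) ∈ (pairQ hp t s).A ↔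
      residue Λ c = 0 := by
  have mk_eq_zero_iff {a : Λ} :
      Ideal.Quotient.mk (Ideal.span {p ^ s}) (a * p ^ (s - 1)) = 0 ↔ residue Λ a = 0 := by
    rw [Ideal.Quotient.eq_zero_iff_mem, Ideal.mem_span_singleton, hΛ.pow_dvd_mul_pow_iff hp hsn,
      Nat.sub_sub_self hs, pow_one, residue_eq_zero_iff, hp, Ideal.mem_span_singleton]
  refine ⟨fun h => ?_, fun h => ?_⟩
  · obtain ⟨e, he⟩ := Submodule.mem_span_singleton.mp h
    have he1 : Ideal.Quotient.mk (Ideal.span {p ^ t}) (e * p ^ (t - 2)) = 0 := congrArg Prod.fst he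
    have he2 : Ideal.Quotient.mk (Ideal.span {p ^ s}) (e * p ^ (s - 1)) =
      Ideal.Quotient.mk _ (c * p ^ (s - 1)) := congrArg Prod.snd he
    rw [Ideal.Quotient.eq_zero_iff_mem, Ideal.mem_span_singleton, hΛ.pow_dvd_mul_pow_iff hp ht,
      Nat.sub_sub_self ht2] at he1
    rw [← mk_eq_zero_iff, ← he2, mk_eq_zero_iff, residue_eq_zero_iff, hp, Ideal.mem_span_singleton]
    exact (dvd_pow_self p two_ne_zero).trans he1
  · rw [mk_eq_zero_iff.mpr h]
    exact zero_mem (pairQ hp t s).A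

end SubPair

theorem smul_add_smul_mem_quotPow_prod_iff (hΛ : IsUniserialOfLength Λ n)
    (hp : maximalIdeal Λ = Ideal.span {p}) {t s : ℕ} (ht : t ≤ n) (ht2 : 2 ≤ t) (hs : 1 ≤ s)
    (hsn : s ≤ n) {i : ℕ} (j : ℕ) (hi : i < t) (c d : Λ) :
    c • ((0, -Ideal.Quotient.mk (Ideal.span {p ^ s}) (p ^ (s - 1))) : _ × _) +
        d • (Ideal.Quotient.mk (Ideal.span {p ^ t}) (p ^ (t - 2)),
          Ideal.Quotient.mk (Ideal.span {p ^ s}) (p ^ (s - 1))) ∈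
        (quotPow p t i).prod (quotPow p s j) ↔
      (i ≤ t - 2 ∨ residue Λ d = 0) ∧ (j ≤ s - 1 ∨ residue Λ c = residue Λ d) := by
  have hsum : c • ((0, -Ideal.Quotient.mk (Ideal.span {p ^ s}) (p ^ (s - 1))) : _ × _) +
      d • (Ideal.Quotient.mk (Ideal.span {p ^ t}) (p ^ (t - 2)),
        Ideal.Quotient.mk (Ideal.span {p ^ s}) (p ^ (s - 1))) =
      (Ideal.Quotient.mk _ (d * p ^ (t - 2)), Ideal.Quotient.mk _ ((d - c) * p ^ (s - 1))) := by
    ext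
    · simp [Algebra.smul_def]
    · simp [Algebra.smul_def, sub_mul, neg_add_eq_sub]
  rw [hsum, eq_comm (a := residue Λ c), ← sub_eq_zero (b := residue Λ c), ← map_sub]
  exact and_congr (mk_mul_pow_mem_quotPow_iff hΛ hp ht (by omega) (by omega))
    (mk_mul_pow_mem_quotPow_iff hΛ hp hsn (by omega) (by omega))

theorem nonempty_F_pairQ_iso (hΛ : IsUniserialOfLength Λ n)
    (hp : maximalIdeal Λ = Ideal.span {p}) {t s : ℕ} (hs : 1 ≤ s) (hst : s - 1 < t - 2)
    (ht : t ≤ n) : Nonempty ((F hΛ).obj (SubPair.pairQ hp t s) ≅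
      Rep.repW (ResidueField Λ) n (s - 1) (t - 2)) := by
  have ht2 : 2 ≤ t := by omega
  have hsn : s ≤ n := by omega
  have hminus := SubPair.minus_pairQ hp ht2 hs
  have hsoc := SubPair.soc_pairQ hp hΛ ht hsn
  have hle : (SubPair.pairQ hp t s).minus ≤ SubPair.soc Λ (SubPair.pairQ hp t s).B :=
    hminus.trans_le (hsoc.ge.trans' (Submodule.prod_mono le_rfl bot_le))
  -- `x ∈ soc B` and `y ∈ A` are chosen so that `x + y = (p ^ (t - 2), 0)` spans `V^{t-2}`.
  let x : (SubPair.pairQ hp t s).B := (0, -Ideal.Quotient.mk (Ideal.span {p ^ s}) (p ^ (s - 1)))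
  let y : (SubPair.pairQ hp t s).B := (Ideal.Quotient.mk (Ideal.span {p ^ t}) (p ^ (t - 2)),
    Ideal.Quotient.mk (Ideal.span {p ^ s}) (p ^ (s - 1)))
  have hx : x ∈ SubPair.soc Λ (SubPair.pairQ hp t s).B :=
    hsoc.ge ⟨zero_mem _, neg_mem (Submodule.mem_span_singleton_self _)⟩
  have hy : y ∈ (SubPair.pairQ hp t s).A := Submodule.mem_span_singleton_self y
  have mem_iff {N : Submodule Λ (SubPair.pairQ hp t s).B} {i j : ℕ} (hi : i < t)
      (hN : N = (quotPow p t i).prod (quotPow p s j)) (c d : Λ) : c • x + d • y ∈ N ↔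
        (i ≤ t - 2 ∨ residue Λ d = 0) ∧ (j ≤ s - 1 ∨ residue Λ c = residue Λ d) :=
    hN ▸ smul_add_smul_mem_quotPow_prod_iff hΛ hp ht ht2 hs hsn j hi c d
  refine nonempty_F_obj_iso_repW hΛ (Submodule.mem_sup_right hx) (Submodule.mem_sup_left hy)
    (SubPair.plus_pairQ_le hp hΛ ht ht2 hs hsn) ?_
  rintro (⟨i, -, -⟩ | _ | _) c d
  · refine (mem_iff (by omega) (SubPair.radPow_sup_minus_pairQ hp ht2 hs i) c d).trans ?_
    rw [Rep.mem_repW_sub_chain_iff hst.le]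
    have hmin : min i (t - 1) ≤ t - 2 ↔ i ≤ t - 2 := by omega
    grind
  · refine (mem_iff (by omega) ((sup_eq_left.mpr hle).trans hsoc) c d).trans ?_
    rw [Rep.mem_repW_sub_prime_iff, or_iff_right (by omega), and_iff_left (.inl le_rfl)]
  · have hcx : -(c • x) = (0, Ideal.Quotient.mk _ (c * p ^ (s - 1))) :=
      Prod.ext (neg_eq_zero.mpr (smul_zero c)) (neg_eq_iff_eq_neg.mpr (smul_neg c _))
    change c • x + d • y ∈ (SubPair.pairQ hp t s).A ⊔ (SubPair.pairQ hp t s).minus ↔ _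
    rw [Rep.mem_repW_sub_dprime_iff, sup_eq_left.mpr (SubPair.minus_le _),
      add_mem_cancel_right (Submodule.smul_mem _ d hy), ← neg_mem_iff, hcx]
    exact SubPair.mk_zero_mem_A_pairQ_iff hp hΛ ht ht2 hs hsn

end PairQ

section Main

variable {Λ : Type u} [CommRing Λ] [IsLocalRing Λ] {n : ℕ} {p : Λ}

theorem nonempty_F_ofIndex_iso (hΛ : IsUniserialOfLength Λ n)
    (hp : maximalIdeal Λ = Ideal.span {p}) :
    ∀ x : SubPair.Index n,
      Nonempty ((F hΛ).obj (SubPair.ofIndex hp x) ≅ x.rep (ResidueField Λ))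
  | .picket _ _ h1 hn hmℓ hm => nonempty_F_picket_iso hΛ hp h1 hn hmℓ hm
  | .pairQ _ _ hs hst ht => nonempty_F_pairQ_iso hΛ hp hs hst ht

theorem restricted_le_essImage_F (hΛ : IsUniserialOfLength Λ n)
    (hp : maximalIdeal Λ = Ideal.span {p}) :
    Rep.restricted (ResidueField Λ) n ≤ (F hΛ).essImage := by
  refine Rep.restricted_le_of_biprod hΛ.one_le _ (fun V hV => ?_)
    (fun x => ⟨_, nonempty_F_ofIndex_iso hΛ hp x⟩) ?_
  · let X : SubPair Λ 2 := { B := PUnit, A := ⊥, bounded := by simp }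
    have hX : IsZero X := SubPair.isZero_iff.mpr (inferInstanceAs (Subsingleton PUnit))
    exact ⟨X, ⟨((F hΛ).map_isZero hX).iso hV⟩⟩
  · rintro V W ⟨X, ⟨eX⟩⟩ ⟨Y, ⟨eY⟩⟩
    have := preservesBinaryBiproducts_of_preservesBiproducts (F hΛ)
    exact ⟨X ⊞ Y, ⟨(F hΛ).mapBiprod X Y ≪≫ biprod.mapIso eX eY⟩⟩

theorem essSurj_F' (hΛ : IsUniserialOfLength Λ n) (hp : maximalIdeal Λ = Ideal.span {p}) :
    (F' hΛ).EssSurj where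
  mem_essImage V := by
    obtain ⟨X, ⟨e⟩⟩ := restricted_le_essImage_F hΛ hp V.obj V.property
    exact ⟨X, ⟨(Rep.restricted (ResidueField Λ) n).isoMk e⟩⟩

theorem indecomposable_ofIndex (hΛ : IsUniserialOfLength Λ n)
    (hp : maximalIdeal Λ = Ideal.span {p}) (x : SubPair.Index n) :
    Indecomposable (SubPair.ofIndex hp x) := by
  obtain ⟨e⟩ := nonempty_F_ofIndex_iso hΛ hp x
  exact indecomposable_of_map (F hΛ) (isZero_of_isZero_F_obj hΛ)
    (indecomposable_of_iso e (x.indecomposable_rep _))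

theorem eq_of_ofIndex_iso (hΛ : IsUniserialOfLength Λ n) (hp : maximalIdeal Λ = Ideal.span {p})
    {x y : SubPair.Index n} (f : SubPair.ofIndex hp x ≅ SubPair.ofIndex hp y) : x = y := by
  obtain ⟨e⟩ := nonempty_F_ofIndex_iso hΛ hp x
  obtain ⟨e'⟩ := nonempty_F_ofIndex_iso hΛ hp y
  exact SubPair.Index.eq_of_rep_iso (e.symm ≪≫ (F hΛ).mapIso f ≪≫ e')

end Main

end BoundedPairs

theorem mainTheorem6 {Λ : Type u} [CommRing Λ] [IsLocalRing Λ] (n : ℕ)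
    (hΛ : IsUniserialOfLength Λ n) (p : Λ) (hp : maximalIdeal Λ = Ideal.span {p}) :
    -- the values of the functor on pickets and on the pairs `Q^t_s`
    (∀ ℓ, 1 ≤ ℓ → ℓ ≤ n →
      Nonempty ((F hΛ).obj (SubPair.picket hp ℓ 0 (M := 2) (by omega)) ≅
        Rep.repV (ResidueField Λ) n (ℓ - 1) 1 0)) ∧
    (∀ ℓ, 1 ≤ ℓ → ℓ ≤ n →
      Nonempty ((F hΛ).obj (SubPair.picket hp ℓ 1 (M := 2) (by omega)) ≅
        Rep.repV (ResidueField Λ) n (ℓ - 1) 1 1)) ∧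
    (∀ ℓ, 2 ≤ ℓ → ℓ ≤ n →
      Nonempty ((F hΛ).obj (SubPair.picket hp ℓ 2 (M := 2) (by omega)) ≅
        Rep.repV (ResidueField Λ) n (ℓ - 2) 0 1)) ∧
    (∀ s t, 1 ≤ s → s - 1 < t - 2 → t ≤ n →
      Nonempty ((F hΛ).obj (SubPair.pairQ hp t s) ≅
        Rep.repW (ResidueField Λ) n (s - 1) (t - 2))) ∧
    -- these representations are indecomposable
    (∀ ℓ, 1 ≤ ℓ → ℓ ≤ n → Indecomposable (Rep.repV (ResidueField Λ) n (ℓ - 1) 1 0)) ∧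
    (∀ ℓ, 1 ≤ ℓ → ℓ ≤ n → Indecomposable (Rep.repV (ResidueField Λ) n (ℓ - 1) 1 1)) ∧
    (∀ ℓ, 2 ≤ ℓ → ℓ ≤ n → Indecomposable (Rep.repV (ResidueField Λ) n (ℓ - 2) 0 1)) ∧
    (∀ s t, 1 ≤ s → s - 1 < t - 2 → t ≤ n →
      Indecomposable (Rep.repW (ResidueField Λ) n (s - 1) (t - 2))) ∧
    -- density
    (F' hΛ).EssSurj ∧
    -- the pickets and the pairs `Q^t_s` are indecomposable and pairwise nonisomorphic
    (∀ x : SubPair.Index n, Indecomposable (SubPair.ofIndex hp x)) ∧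
    (∀ x y : SubPair.Index n,
      Nonempty (SubPair.ofIndex hp x ≅ SubPair.ofIndex hp y) → x = y) := by
  exact ⟨fun _ h1 hn => nonempty_F_picket_iso hΛ hp h1 hn (by omega) (by omega),
    fun _ h1 hn => nonempty_F_picket_iso hΛ hp h1 hn h1 (by omega),
    fun _ h2 hn => nonempty_F_picket_iso hΛ hp (by omega) hn h2 (by omega),
    fun _ _ hs hst ht => nonempty_F_pairQ_iso hΛ hp hs hst ht,
    fun _ _ _ => Rep.indecomposable_repV _ _ _,
    fun _ _ _ => Rep.indecomposable_repV _ _ _,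
    fun _ _ _ => Rep.indecomposable_repV _ _ _,
    fun _ _ _ hst ht => Rep.indecomposable_repW hst (by omega),
    essSurj_F' hΛ hp, indecomposable_ofIndex hΛ hp,
    fun _ _ ⟨f⟩ => eq_of_ofIndex_iso hΛ hp f⟩
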